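/- **Theorem (regret of Online_MU).** *Model.* $M$ users share one channel. In each carrier sensing period, of length $\zeta>0$, user $i$ attempts to access independently with probability $p_i\in[0,1]$; the contention succeeds iff exactly one user attempts, which has probability $p_s=\sum_i p_i\prod_{j\ne i}(1-p_j)$, assumed positive. The channel qualities $X$ seen at the successive successful contentions are IID and independent of the attempts, bounded, with $E[X]>0$ and a cdf satisfying $|F(x+\delta)-F(x)|\le \mathcal L|\delta|^{\alpha}$ for all $x,\delta$ (for some $\mathcal L$ and $\alpha>0$). At a successful contention the winner sees $X$ and either transmits for a time $K>0$, which ends the meta stage, or releases the channel. A meta stage whose transmission starts at the $k$-th successful contention earns $X_kK/(T_k+K)$, where $T_k$ is the time spent on contention in the stage, that is, $\zeta$ times the number of carrier sensing periods used. Meta stages are IID. *Reference policy (Offline_MU).* In every meta stage, transmit at the first successful contention with $X\ge x^*$, where $u=x^*$ is the unique solution of $E[X-u]^+=u\zeta/(p_sK)$. *Algorithm (Online_MU, with $0<z<1$, $L>0$).* Initially each user accesses the channel once and keeps the observed quality as a sample; let $n_j$ be the number of accesses (transmissions) of user $j$ so far, initially $1$. In meta stage $l=1,2,\dots$ let $\mathcal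 E(l)=\{j:n_j<L\,l^z\log l\}$. If $\mathcal E(l)\neq\emptyset$, a user chosen uniformly at random from $\mathcal E(l)$ transmits at the first successful contention of the stage and records the quality. If $\mathcal E(l)=\emptyset$, each user $j$ solves the equation for $x^*$ with the law of $X$ replaced by the empirical law of the samples recorded before stage $l$ by the users in a fixed set $\mathcal N_j\ni j$ (for example $\mathcal N_j=\{j\}$, own samples, or $\mathcal N_j=$ all users), and transmits when it wins a contention and sees a quality at least equal to its solution; every quality seen during the stage is recorded by the user who saw it. In both cases $n_j$ increases by one for the user who transmitted. *Regret.* $R_I(H)$ is the expected total reward of Offline_MU over the meta stages $1,\dots,H$ minus that of Online_MU. Let $\Delta^*=\operatorname{ess\,sup}X-\operatorname{ess\,inf}X$ and $s_q(H)=\sum_{l=1}^H l^{-q}$. *Claim.* The total rewards are integrable, and there are constants $L_0,\hat C_1,\hat C_2>0$ such that for every $L\ge L_0$ and all $H$ $$R_I(H)\le\Delta^*\Bigl\{M L H^z\log H+\hat C_1\,s_{\alpha z/2}(H)+\hat C_2\,s_2(H)\Bigr\}.$$ Moreover $R_I(H)/H\to0$ as $H\to\infty$ for every $L\ge L_0$;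 the regret is sublinear. -/

import Mathlib

open MeasureTheory ProbabilityTheory Filter Topology

noncomputable section

/-- Data of the multiuser single-channel model with `M` users: `p i` is the probability that user
`i` attempts to access the idle channel in a carrier sensing period, `ζ` is the length of such a
period, `K` is the length of a transmission, and `law` is the common law of the channel qualities
seen at the successful contentions. -/
structure ModelI (M : ℕ) where
  p : Fin M → unitInterval
  ζ : ℝ
  K : ℝ
  law : Measure ℝ
  [isProb : IsProbabilityMeasure law]

attribute [instance] ModelI.isProb

instance instMeasurableSpacePermFin (M : ℕ) : MeasurableSpace (Equiv.Perm (Fin M)) := ⊤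

instance instDiscretePermFin (M : ℕ) : DiscreteMeasurableSpace (Equiv.Perm (Fin M)) :=
  ⟨fun _ => trivial⟩

/-- Everything random that belongs to one meta stage:
* `s.1 n i`: does user `i` attempt to access in the `n`-th carrier sensing period (`n = 0, 1, …`);
* `s.2.1 k`: the channel quality at the `k`-th successful contention (`k = 0, 1, …`);
* `s.2.2`: a random ordering of the users, used only for a random choice among users. -/
abbrev Stage (M : ℕ) : Type := (ℕ → Fin M → Bool) × (ℕ → ℝ) × Equiv.Perm (Fin M)

namespace ModelI

variable {M : ℕ}

/-- Probability that exactly one user attempts to access. -/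
def ps (m : ModelI M) : ℝ :=
  ∑ i, (m.p i : ℝ) * ∏ j ∈ Finset.univ.erase i, (1 - (m.p j : ℝ))

/-- Law of one meta stage: independent Bernoulli attempts, IID channel qualities, and a uniformly
random ordering of the users, all independent. -/
def stageLaw (m : ModelI M) : Measure (Stage M) :=
  (Measure.infinitePi fun _ : ℕ =>
      Measure.pi fun i : Fin M => bernoulliMeasure true false (m.p i)).prod
    ((Measure.infinitePi fun _ : ℕ => m.law).prod
      (uniformOn (Set.univ : Set (Equiv.Perm (Fin M)))))

instance (m : ModelI M) : IsProbabilityMeasure m.stageLaw := by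
  unfold stageLaw; infer_instance

/-- Law of the whole system: the stages `0, 1, 2, …` are IID. Stage `0` is the initialization,
the meta stages proper are `1, 2, …`. -/
def P (m : ModelI M) : Measure (ℕ → Stage M) := Measure.infinitePi fun _ => m.stageLaw

instance (m : ModelI M) : IsProbabilityMeasure m.P := by
  unfold P; infer_instance

/-- The largest difference between two channel realizations (there are no sensing costs here). -/
def Δstar (m : ModelI M) : ℝ := essSup (fun x : ℝ => x) m.law - essInf (fun x : ℝ => x) m.law

end ModelI

namespace Stage

variable {M : ℕ}

/-- The contention in period `n` succeeds: exactly one user attempts. -/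
def Success (s : Stage M) (n : ℕ) : Prop := ∃! i, s.1 n i = true

/-- The period of the `k`-th successful contention. -/
def successPeriod (s : Stage M) (k : ℕ) : ℕ := Nat.nth s.Success k

/-- User `i` wins the `k`-th successful contention. -/
def Wins (s : Stage M) (k : ℕ) (i : Fin M) : Prop :=
  s.Success (s.successPeriod k) ∧ s.1 (s.successPeriod k) i = true

/-- Channel quality at the `k`-th successful contention. -/
def X (s : Stage M) (k : ℕ) : ℝ := s.2.1 k

/-- Rate of the transmission that starts at the `k`-th successful contention: the reward `X K`
divided by the total time, contention plus transmission. -/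
def rate (m : ModelI M) (s : Stage M) (k : ℕ) : ℝ :=
  s.X k * m.K / (m.ζ * ((s.successPeriod k : ℝ) + 1) + m.K)

/-- With individual thresholds `θ`, the winner of the `k`-th successful contention transmits. -/
def StopsAt (θ : Fin M → ℝ) (s : Stage M) (k : ℕ) : Prop := ∃ i, s.Wins k i ∧ θ i ≤ s.X k

/-- The first decision epoch at which the threshold rule transmits (`0` if there is none, which
`thresholdReward` takes care of). -/
def stopEpoch (θ : Fin M → ℝ) (s : Stage M) : ℕ := sInf {k | s.StopsAt θ k}

open Classical in
/-- Reward of the threshold rule in one stage (`0` if it never transmits). -/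
def thresholdReward (m : ModelI M) (θ : Fin M → ℝ) (s : Stage M) : ℝ :=
  if ∃ k, s.StopsAt θ k then s.rate m (s.stopEpoch θ) else 0

/-- Uniformly random element of a nonempty set of users: the first one in the random ordering. -/
def pick (s : Stage M) (E : Finset (Fin M)) (hE : E.Nonempty) : Fin M :=
  s.2.2.symm ((E.image s.2.2).min' (hE.image _))

end Stage

/-- `u` solves the threshold equation `E[X - u]⁺ = c u` for `X ∼ μ`. -/
def IsThreshold (c : ℝ) (μ : Measure ℝ) (u : ℝ) : Prop := ∫ x, max (x - u) 0 ∂μ = c * u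

/-- The solution of the threshold equation; see `existsUnique_isThreshold`. -/
def threshold (c : ℝ) (μ : Measure ℝ) : ℝ := Classical.epsilon (IsThreshold c μ)

theorem integrable_max_sub {μ : Measure ℝ} [IsProbabilityMeasure μ]
    (hμ : Integrable (fun x : ℝ => x) μ) (u : ℝ) : Integrable (fun x : ℝ => max (x - u) 0) μ :=
  (hμ.sub (integrable_const u)).pos_part

/-- The threshold equation has exactly one solution. -/
theorem existsUnique_isThreshold {c : ℝ} (hc : 0 < c) {μ : Measure ℝ} [IsProbabilityMeasure μ]
    (hμ : Integrable (fun x : ℝ => x) μ) : ∃! u, IsThreshold c μ u := by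
  set f : ℝ → ℝ := fun u => ∫ x, max (x - u) 0 ∂μ with hf
  have hint := integrable_max_sub hμ
  have hanti : Antitone f := by
    intro u v huv
    refine integral_mono (hint v) (hint u) fun x => ?_
    exact max_le_max (by linarith) le_rfl
  have hlip : ∀ u v, u ≤ v → f u ≤ f v + (v - u) := by
    intro u v huv
    have h : f u ≤ ∫ x, (max (x - v) 0 + (v - u)) ∂μ := by
      refine integral_mono (hint u) ((hint v).add (integrable_const _)) fun x => ?_
      refine max_le ?_ ?_
      · have := le_max_left (x - v) 0
        linarith
      · have := le_max_right (x - v) 0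
        linarith
    rw [integral_add (hint v) (integrable_const _)] at h
    simpa using h
  have hcont : Continuous f := by
    refine (LipschitzWith.of_dist_le_mul (K := 1) fun u v => ?_).continuous
    rw [Real.dist_eq, Real.dist_eq, NNReal.coe_one, one_mul, abs_le]
    rcases le_total u v with h | h
    · have h1 := hlip u v h
      have h2 := hanti h
      rw [abs_sub_comm, abs_of_nonneg (sub_nonneg.2 h)]
      constructor <;> linarith
    · have h1 := hlip v u h
      have h2 := hanti h
      rw [abs_of_nonneg (sub_nonneg.2 h)]
      constructor <;> linarith
  have h0 : 0 ≤ f 0 := integral_nonneg fun x => le_max_right _ _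
  have hb : 0 ≤ f 0 / c := by positivity
  have hex : (0 : ℝ) ∈ (fun u => c * u - f u) '' Set.Icc 0 (f 0 / c) := by
    refine intermediate_value_Icc hb (by fun_prop) ⟨by simpa using h0, ?_⟩
    have h1 := hanti hb
    have h2 : c * (f 0 / c) = f 0 := by field_simp
    simp only [h2]
    linarith
  obtain ⟨u, -, hu⟩ := hex
  have huf : f u = c * u := by
    simp only at hu
    linarith
  refine ⟨u, huf, fun v hv => ?_⟩
  have hvf : f v = c * v := hv
  rcases lt_trichotomy v u with h | h | h
  · have := hanti h.le
    nlinarith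
  · exact h
  · have := hanti h.le
    nlinarith

theorem isThreshold_threshold {c : ℝ} (hc : 0 < c) {μ : Measure ℝ} [IsProbabilityMeasure μ]
    (hμ : Integrable (fun x : ℝ => x) μ) : IsThreshold c μ (threshold c μ) :=
  Classical.epsilon_spec (existsUnique_isThreshold hc hμ).exists

/-- The reference policy `Offline_MU`: every user uses the threshold `x*` with
`E[X - x*]⁺ = x* ζ / (p_s K)`. This is its reward in one stage. -/
def offlineReward {M : ℕ} (m : ModelI M) (s : Stage M) : ℝ :=
  s.thresholdReward m fun _ => threshold (m.ζ / (m.ps * m.K)) m.law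

namespace OnlineMU

variable {M : ℕ}

/-- Memory of the algorithm: `count j` is the number `n_j` of times user `j` has accessed the
channel; `obs j` is the set of pairs `(l, k)` such that user `j` has observed the channel quality
at the `k`-th successful contention of stage `l`. -/
structure Memory (M : ℕ) where
  count : Fin M → ℕ
  obs : Fin M → Finset (ℕ × ℕ)

/-- Initialization: in stage `0` each user accesses the channel once. -/
def init : Memory M where
  count _ := 1
  obs j := {(0, (j : ℕ))}

/-- The exploration function `D₁(l) = L l^z log l`. -/
def D₁ (L z : ℝ) (l : ℕ) : ℝ := L * (l : ℝ) ^ z * Real.log l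

open Classical in
/-- The users that are to be explored in stage `l`. -/
def explore (L z : ℝ) (l : ℕ) (S : Memory M) : Finset (Fin M) :=
  Finset.univ.filter fun j => (S.count j : ℝ) < D₁ L z l

/-- Empirical law of the observed qualities with indices in `I`. -/
def empirical (I : Finset (ℕ × ℕ)) (ω : ℕ → Stage M) : Measure ℝ :=
  (I.card : ENNReal)⁻¹ • ∑ i ∈ I, Measure.dirac ((ω i.1).X i.2)

open Classical in
/-- The thresholds used in an exploitation stage. User `j` solves the threshold equation for the
empirical law of the samples collected by the users in `share j`; `share j = {j}` is the use of
own samples only, `share j = Finset.univ` is the use of all samples. -/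
def estThreshold (m : ModelI M) (share : Fin M → Finset (Fin M)) (S : Memory M)
    (ω : ℕ → Stage M) (j : Fin M) : ℝ :=
  threshold (m.ζ / (m.ps * m.K)) (empirical ((share j).biUnion S.obs) ω)

open Classical in
/-- Memory after stage `l`, given the memory `S` before it. In an exploration stage a random user
of the exploration set transmits at the first decision epoch. In an exploitation stage the
threshold rule is run; all qualities seen up to its end are recorded, each by the user who saw it,
and the count of the transmitting user is increased. -/
def update (m : ModelI M) (share : Fin M → Finset (Fin M)) (L z : ℝ) (ω : ℕ → Stage M)
    (l : ℕ) (S : Memory M) : Memory M :=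
  if hE : (explore L z l S).Nonempty then
    let i := (ω l).pick (explore L z l S) hE
    { count := fun j => if j = i then S.count j + 1 else S.count j
      obs := fun j => if j = i then insert (l, 0) (S.obs j) else S.obs j }
  else
    let θ := estThreshold m share S ω
    if ∃ k, (ω l).StopsAt θ k then
      let τ := (ω l).stopEpoch θ
      { count := fun j => if (ω l).Wins τ j then S.count j + 1 else S.count j
        obs := fun j => S.obs j ∪
          ((Finset.range (τ + 1)).filter fun k => (ω l).Wins k j).image fun k => (l, k) }
    else S

/-- Memory at the end of stage `l`. -/
def memory (m : ModelI M) (share : Fin M → Finset (Fin M)) (L z : ℝ) (ω : ℕ → Stage M) :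
    ℕ → Memory M
  | 0 => init
  | l + 1 => update m share L z ω (l + 1) (memory m share L z ω l)

open Classical in
/-- Reward of the algorithm in stage `l` (used for `l ≥ 1`). -/
def reward (m : ModelI M) (share : Fin M → Finset (Fin M)) (L z : ℝ) (l : ℕ)
    (ω : ℕ → Stage M) : ℝ :=
  let S := memory m share L z ω (l - 1)
  if (explore L z l S).Nonempty then (ω l).rate m 0
  else (ω l).thresholdReward m (estThreshold m share S ω)

/-- The regret over `H` meta stages with respect to `Offline_MU`. -/
def regret (m : ModelI M) (share : Fin M → Finset (Fin M)) (L z : ℝ) (H : ℕ) : ℝ :=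
  ∫ ω, ∑ l ∈ Finset.Icc 1 H, offlineReward m (ω l) ∂m.P
    - ∫ ω, ∑ l ∈ Finset.Icc 1 H, reward m share L z l ω ∂m.P

end OnlineMU

/-- `s_q(H) = ∑_{l=1}^H l^{-q}`. -/
def sSum (q : ℝ) (H : ℕ) : ℝ := ∑ l ∈ Finset.Icc 1 H, 1 / (l : ℝ) ^ q

end

/-!
The stages split into three kinds, and each kind contributes one term to the regret.

*Exploration stages.* Their number up to stage `H` is at most `M L H^z log H`, since each of them
increases by one a count that is below the exploration function (`OnlineMU.sum_explore_le`, by the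
potential `∑ⱼ min nⱼ N`). The reference policy stops at a nonnegative quality and not before the
first successful contention, so in such a stage it gains at most `Δ*` over the algorithm
(`Stage.thresholdReward_sub_rate_zero_le`).

*Exploitation stages with accurate estimates*, that is, all estimated thresholds within
`ε = l^(-z/2)` of `x*`. Both policies then act alike unless the first quality that is at least
`x* - ε` is below `x* + ε`. Given the past this has probability at most
`P(x* - ε ≤ X < x* + ε) / P(X ≥ x* - ε)`, which is of order `ε^α` by the Hölder condition
(`OnlineMU.measure_disagree_of_near_le`).

*Exploitation stages with a bad estimate.* The difference of the two sides of the threshold equation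
has slope at most `-c` in `u`, where `c = ζ / (p_s K)`. An estimate off by more than `ε` therefore
forces a sample mean of `(X - u)⁺`, with `u = x* ± ε`, to be off by at least `c ε`. The samples are
collected adaptively and their number is random, but whether the `k`-th quality of a stage is
recorded is decided before that quality is revealed. Hence for every `φ ≥ 0` with `E[φ(X)] ≤ 1` the
product of `φ` over all recorded samples has mean at most one
(`OnlineMU.lintegral_prod_samples_le_one`). With the exponential factor of Hoeffding's lemma and
Markov's inequality this gives a Hoeffding bound in which only the guaranteed number `L l^z log l`
of samples enters (`OnlineMU.measure_samples_deviation_le`); for `L` large it is at most `l⁻²`.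
Here it matters that every stage ends almost surely: an estimated threshold lies below zero or below
a sample, so it is exceeded with positive probability.

The last two kinds cost at most twice the bound of `|X|` and only when the rewards disagree, which
holds for the absolute value as well. So the regret is `o(H)` from both sides.
-/

/-! ### Independent sequences -/

section Sequences

open scoped ENNReal

variable {Ω : Type*} [MeasurableSpace Ω] {μ : Measure Ω} [IsProbabilityMeasure μ]

theorem lintegral_prod_infinitePi (s : Finset ℕ) {f : ℕ → Ω → ℝ≥0∞}
    (hf : ∀ i, Measurable (f i)) :
    ∫⁻ x, ∏ i ∈ s, f i (x i) ∂(Measure.infinitePi fun _ : ℕ => μ)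
      = ∏ i ∈ s, ∫⁻ y, f i y ∂μ := by
  rw [lintegral_prod_eq_prod_lintegral_of_indepFun s (fun i (x : ℕ → Ω) => f i (x i))
    (iIndepFun_infinitePi (P := fun _ : ℕ => μ) hf)
    (fun i => (hf i).comp (measurable_pi_apply i))]
  refine Finset.prod_congr rfl fun i _ => ?_
  exact (measurePreserving_eval_infinitePi (fun _ : ℕ => μ) i).lintegral_comp (hf i)

/-- Resampling one coordinate of an IID sequence does not change its law. With Fubini this is how
one stage is integrated out while the others are held fixed. -/
theorem measurePreserving_update (n : ℕ) :
    MeasurePreserving (fun q : (ℕ → Ω) × Ω => Function.update q.1 n q.2)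
      ((Measure.infinitePi fun _ : ℕ => μ).prod μ) (Measure.infinitePi fun _ : ℕ => μ) := by
  have hm : Measurable (fun q : (ℕ → Ω) × Ω => Function.update q.1 n q.2) := by
    refine measurable_pi_lambda _ fun k => ?_
    by_cases hk : k = n
    · subst hk
      simpa using measurable_snd
    · simp only [Function.update_of_ne hk]
      exact (measurable_pi_apply k).comp measurable_fst
  refine ⟨hm, Measure.eq_infinitePi _ fun s t ht => ?_⟩
  rw [Measure.map_apply hm (MeasurableSet.pi s.countable_toSet fun i _ => ht i)]
  by_cases hn : n ∈ s
  · have hpre : (fun q : (ℕ → Ω) × Ω => Function.update q.1 n q.2) ⁻¹' Set.pi s t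
        = Set.pi (s.erase n : Finset ℕ) t ×ˢ t n := by
      ext ⟨x, y⟩
      simp only [Set.mem_preimage, Set.mem_pi, Set.mem_prod, Finset.coe_erase, Set.mem_sdiff,
        Finset.mem_coe, Set.mem_singleton_iff]
      constructor
      · intro h
        refine ⟨fun i hi => ?_, by simpa using h n hn⟩
        simpa [Function.update_of_ne hi.2] using h i hi.1
      · rintro ⟨h1, h2⟩ i hi
        by_cases hin : i = n
        · subst hin
          simpa using h2
        · simpa [Function.update_of_ne hin] using h1 i ⟨hi, hin⟩
    rw [hpre, Measure.prod_prod, Measure.infinitePi_pi _ (fun i _ => ht i), mul_comm,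
      Finset.mul_prod_erase s (fun i => μ (t i)) hn]
  · have hpre : (fun q : (ℕ → Ω) × Ω => Function.update q.1 n q.2) ⁻¹' Set.pi s t
        = Set.pi s t ×ˢ Set.univ := by
      ext ⟨x, y⟩
      simp only [Set.mem_preimage, Set.mem_pi, Set.mem_prod, Set.mem_univ, and_true]
      refine forall₂_congr fun i hi => ?_
      rw [Function.update_of_ne (ne_of_mem_of_not_mem (Finset.mem_coe.1 hi) hn)]
    rw [hpre, Measure.prod_prod, Measure.infinitePi_pi _ (fun i _ => ht i), measure_univ, mul_one]

open Classical in
/-- A product of independent factors of mean at most one, stopped at the first entry into the sets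
`B k`, has mean at most one (it is counted as `0` where no entry happens). -/
theorem lintegral_stopped_prod_le_one {B : ℕ → Set Ω} (hB : ∀ k, MeasurableSet (B k))
    {ψ : ℕ → Ω → ℝ≥0∞} (hψ : ∀ k, Measurable (ψ k)) (h1 : ∀ k, ∫⁻ y, ψ k y ∂μ ≤ 1) :
    ∫⁻ x, (if ∃ k, x k ∈ B k then
        ∏ i ∈ Finset.range (sInf {k | x k ∈ B k} + 1), ψ i (x i) else 0)
      ∂(Measure.infinitePi fun _ : ℕ => μ) ≤ 1 := by
  set a : ℕ → ℝ≥0∞ := fun i => ∫⁻ y, (B i)ᶜ.indicator (ψ i) y ∂μ with ha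
  set b : ℕ → ℝ≥0∞ := fun i => ∫⁻ y, (B i).indicator (ψ i) y ∂μ with hb
  have hab : ∀ i, b i + a i ≤ 1 := by
    intro i
    rw [hb, ha]
    simp only
    rw [lintegral_indicator (hB i), lintegral_indicator (hB i).compl,
      lintegral_add_compl _ (hB i)]
    exact h1 i
  set f : ℕ → ℕ → Ω → ℝ≥0∞ := fun k i =>
    if i = k then (B k).indicator (ψ k) else (B i)ᶜ.indicator (ψ i) with hf
  have hfm : ∀ k i, Measurable (f k i) := by
    intro k i
    simp only [hf]
    split_ifs
    · exact (hψ k).indicator (hB k)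
    · exact (hψ i).indicator (hB i).compl
  have hle : ∀ x : ℕ → Ω, (if ∃ k, x k ∈ B k then
        ∏ i ∈ Finset.range (sInf {k | x k ∈ B k} + 1), ψ i (x i) else 0)
      ≤ ∑' k, ∏ i ∈ Finset.range (k + 1), f k i (x i) := by
    intro x
    split_ifs with h
    · set τ := sInf {k | x k ∈ B k} with hτ
      have hτm : x τ ∈ B τ := Nat.sInf_mem (s := {k | x k ∈ B k}) h
      refine le_trans (le_of_eq ?_) (ENNReal.le_tsum τ)
      refine Finset.prod_congr rfl fun i hi => ?_
      simp only [hf]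
      split_ifs with hi2
      · subst hi2
        rw [Set.indicator_of_mem hτm]
      · have hlt : i < τ := by
          have := Finset.mem_range.1 hi
          omega
        have : x i ∉ B i := fun hmem => Nat.notMem_of_lt_sInf hlt hmem
        rw [Set.indicator_of_mem (s := (B i)ᶜ) this]
    · exact zero_le
  refine (lintegral_mono hle).trans ?_
  have hprod : ∀ k, Measurable fun x : ℕ → Ω => ∏ i ∈ Finset.range (k + 1), f k i (x i) :=
    fun k => Finset.measurable_fun_prod _ fun i _ => (hfm k i).comp (measurable_pi_apply i)
  rw [lintegral_tsum fun k => (hprod k).aemeasurable]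
  have hterm : ∀ k, ∫⁻ x, ∏ i ∈ Finset.range (k + 1), f k i (x i)
      ∂(Measure.infinitePi fun _ : ℕ => μ) = (∏ i ∈ Finset.range k, a i) * b k := by
    intro k
    rw [lintegral_prod_infinitePi _ (hfm k), Finset.prod_range_succ]
    congr 1
    · refine Finset.prod_congr rfl fun i hi => ?_
      have : i ≠ k := (Finset.mem_range.1 hi).ne
      simp [hf, ha, this]
    · simp [hf, hb]
  simp only [hterm]
  have hpart : ∀ n, ∑ k ∈ Finset.range n, (∏ i ∈ Finset.range k, a i) * b k
      + ∏ i ∈ Finset.range n, a i ≤ 1 := by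
    intro n
    induction n with
    | zero => simp
    | succ n ih =>
      rw [Finset.sum_range_succ, Finset.prod_range_succ, add_assoc, ← mul_add]
      refine le_trans (add_le_add_right ?_ _) ih
      calc (∏ i ∈ Finset.range n, a i) * (b n + a n)
          ≤ (∏ i ∈ Finset.range n, a i) * 1 := by gcongr; exact hab n
        _ = _ := mul_one _
  exact ENNReal.tsum_le_of_sum_range_le fun n => le_self_add.trans (hpart n)

theorem ae_exists_mem_of_le_measure {B : ℕ → Set Ω} (hB : ∀ k, MeasurableSet (B k))
    {δ : ℝ≥0∞} (hδ : 0 < δ) (h : ∀ k, δ ≤ μ (B k)) :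
    ∀ᵐ x ∂(Measure.infinitePi fun _ : ℕ => μ), ∃ k, x k ∈ B k := by
  have hset : {x : ℕ → Ω | ¬ ∃ k, x k ∈ B k} = ⋂ k, {x | x k ∉ B k} := by
    ext x
    simp
  rw [ae_iff, hset]
  have hn : ∀ n : ℕ, (Measure.infinitePi fun _ : ℕ => μ) (⋂ k, {x : ℕ → Ω | x k ∉ B k})
      ≤ (1 - δ) ^ n := by
    intro n
    calc (Measure.infinitePi fun _ : ℕ => μ) (⋂ k, {x : ℕ → Ω | x k ∉ B k})
        ≤ (Measure.infinitePi fun _ : ℕ => μ)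
            (Set.pi (Finset.range n : Finset ℕ) fun k => (B k)ᶜ) := by
          refine measure_mono fun x hx k _ => ?_
          exact Set.mem_iInter.1 hx k
      _ = ∏ i ∈ Finset.range n, μ ((B i)ᶜ) := by
          rw [Measure.infinitePi_pi _ fun i _ => (hB i).compl]
      _ ≤ ∏ i ∈ Finset.range n, (1 - δ) := by
          gcongr with i
          rw [prob_compl_eq_one_sub (hB i)]
          exact tsub_le_tsub_left (h i) 1
      _ = (1 - δ) ^ n := by simp
  have hlt : 1 - δ < 1 := ENNReal.sub_lt_self ENNReal.one_ne_top one_ne_zero hδ.ne'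
  exact le_antisymm (ge_of_tendsto' (ENNReal.tendsto_pow_atTop_nhds_zero_of_lt_one hlt) hn)
    zero_le

/-- The first element outside `A` of an IID sequence lies in `C` with probability at most
`μ C / μ Aᶜ`. -/
theorem measure_first_exit_le {A C : Set Ω} (hA : MeasurableSet A) (hC : MeasurableSet C) :
    (Measure.infinitePi fun _ : ℕ => μ) {x | ∃ k, (∀ i < k, x i ∈ A) ∧ x k ∈ C}
      ≤ (μ Aᶜ)⁻¹ * μ C := by
  set t : ℕ → ℕ → Set Ω := fun k i => if i = k then C else A with ht
  have hsub : {x : ℕ → Ω | ∃ k, (∀ i < k, x i ∈ A) ∧ x k ∈ C}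
      ⊆ ⋃ k, Set.pi (Finset.range (k + 1) : Finset ℕ) (t k) := by
    rintro x ⟨k, h1, h2⟩
    refine Set.mem_iUnion.2 ⟨k, fun i hi => ?_⟩
    simp only [ht]
    split_ifs with hik
    · exact hik ▸ h2
    · refine h1 i ?_
      have := Finset.mem_range.1 (Finset.mem_coe.1 hi)
      omega
  refine (measure_mono hsub).trans ((measure_iUnion_le _).trans ?_)
  have hterm : ∀ k, (Measure.infinitePi fun _ : ℕ => μ)
      (Set.pi (Finset.range (k + 1) : Finset ℕ) (t k)) = (μ A) ^ k * μ C := by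
    intro k
    rw [Measure.infinitePi_pi _ fun i _ => by simp only [ht]; split_ifs <;> assumption,
      Finset.prod_range_succ]
    congr 1
    · rw [Finset.prod_congr rfl (g := fun _ => μ A)]
      · simp
      · intro i hi
        have : i ≠ k := (Finset.mem_range.1 hi).ne
        simp [ht, this]
    · simp [ht]
  simp only [hterm]
  rw [ENNReal.tsum_mul_right, ENNReal.tsum_geometric, prob_compl_eq_one_sub hA]

end Sequences

/-! ### The threshold equation -/

section Threshold

theorem integral_max_sub_mono {μ : Measure ℝ} [IsProbabilityMeasure μ]
    (hμ : Integrable (fun x : ℝ => x) μ) {u v : ℝ} (huv : u ≤ v) :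
    ∫ x, max (x - v) 0 ∂μ ≤ ∫ x, max (x - u) 0 ∂μ :=
  integral_mono (integrable_max_sub hμ v) (integrable_max_sub hμ u) fun x =>
    max_le_max (by linarith) le_rfl

theorem le_threshold_iff {c : ℝ} (hc : 0 < c) {μ : Measure ℝ} [IsProbabilityMeasure μ]
    (hμ : Integrable (fun x : ℝ => x) μ) (u : ℝ) :
    u ≤ threshold c μ ↔ c * u ≤ ∫ x, max (x - u) 0 ∂μ := by
  have h := isThreshold_threshold hc hμ
  unfold IsThreshold at h
  constructor
  · intro hu
    have := integral_max_sub_mono hμ hu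
    nlinarith
  · intro hu
    by_contra! hlt
    have := integral_max_sub_mono hμ hlt.le
    nlinarith

theorem threshold_nonneg {c : ℝ} (hc : 0 < c) {μ : Measure ℝ} [IsProbabilityMeasure μ]
    (hμ : Integrable (fun x : ℝ => x) μ) : 0 ≤ threshold c μ := by
  rw [le_threshold_iff hc hμ]
  simpa using integral_nonneg fun x => le_max_right _ _

theorem threshold_pos {c : ℝ} (hc : 0 < c) {μ : Measure ℝ} [IsProbabilityMeasure μ]
    (hμ : Integrable (fun x : ℝ => x) μ) (hmean : 0 < ∫ x, x ∂μ) : 0 < threshold c μ := by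
  refine (threshold_nonneg hc hμ).lt_of_ne fun h0 => ?_
  have h := isThreshold_threshold hc hμ
  unfold IsThreshold at h
  rw [← h0] at h
  have : ∫ x, x ∂μ ≤ ∫ x, max (x - 0) 0 ∂μ :=
    integral_mono hμ (integrable_max_sub hμ 0) fun x => by simp
  simp only [mul_zero] at h
  linarith

/-- Otherwise the left side of the threshold equation would vanish, although its solution is
positive. -/
theorem measure_Ici_threshold_pos {c : ℝ} (hc : 0 < c) {μ : Measure ℝ} [IsProbabilityMeasure μ]
    (hμ : Integrable (fun x : ℝ => x) μ) (hmean : 0 < ∫ x, x ∂μ) :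
    0 < μ (Set.Ici (threshold c μ)) := by
  have hpos := threshold_pos hc hμ hmean
  have h := isThreshold_threshold hc hμ
  unfold IsThreshold at h
  refine pos_iff_ne_zero.2 fun h0 => ?_
  have hae : ∀ᵐ x ∂μ, max (x - threshold c μ) 0 = 0 := by
    have : ∀ᵐ x ∂μ, x ∉ Set.Ici (threshold c μ) := measure_eq_zero_iff_ae_notMem.1 h0
    filter_upwards [this] with x hx
    simp only [Set.mem_Ici, not_le] at hx
    exact max_eq_right (by linarith)
  rw [integral_congr_ae hae] at h
  simp only [integral_zero] at h
  have : 0 < c * threshold c μ := by positivity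
  linarith

/-- The set `{x | μ [x, ∞) = 0}` is an upper half-line, hence a countable union of null
half-lines. -/
theorem ae_measure_Ici_pos (μ : Measure ℝ) [IsProbabilityMeasure μ] :
    ∀ᵐ x ∂μ, 0 < μ (Set.Ici x) := by
  have hmeas : {x | ¬ 0 < μ (Set.Ici x)} = {x | μ (Set.Ici x) = 0} := by
    ext x
    simp
  rw [ae_iff, hmeas]
  set N := {x | μ (Set.Ici x) = 0} with hN
  have hup : ∀ x ∈ N, ∀ y, x ≤ y → y ∈ N := fun x hx y hxy =>
    measure_mono_null (Set.Ici_subset_Ici.2 hxy) hx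
  by_cases hne : N.Nonempty
  · by_cases hbd : BddBelow N
    · -- `N` is a half-line; exhaust it by countably many `[x_n, ∞)` with `x_n ∈ N`
      by_cases hmem : sInf N ∈ N
      · have : N ⊆ Set.Ici (sInf N) := fun x hx => csInf_le hbd hx
        exact measure_mono_null this hmem
      · have hsub : N ⊆ ⋃ n : ℕ, Set.Ici (sInf N + 1 / ((n : ℝ) + 1)) := by
          intro x hx
          have hlt : sInf N < x := (csInf_le hbd hx).lt_of_ne fun h => hmem (h ▸ hx)
          obtain ⟨n, hn⟩ := exists_nat_one_div_lt (sub_pos.2 hlt)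
          exact Set.mem_iUnion.2 ⟨n, by simp only [Set.mem_Ici]; linarith⟩
        refine measure_mono_null hsub (measure_iUnion_null fun n => ?_)
        have hpos : (0 : ℝ) < 1 / ((n : ℝ) + 1) := by positivity
        obtain ⟨y, hy, hlt⟩ := exists_lt_of_csInf_lt hne (lt_add_of_pos_right (sInf N) hpos)
        exact hup y hy _ hlt.le
    · exfalso
      have huniv : (Set.univ : Set ℝ) ⊆ ⋃ n : ℕ, Set.Ici (-(n : ℝ)) := by
        intro x _
        obtain ⟨n, hn⟩ := exists_nat_ge (-x)
        exact Set.mem_iUnion.2 ⟨n, by simp only [Set.mem_Ici]; linarith⟩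
      have h0 : μ Set.univ = 0 := by
        refine measure_mono_null huniv (measure_iUnion_null fun n => ?_)
        obtain ⟨y, hy, hlt⟩ := not_bddBelow_iff.1 hbd (-(n : ℝ))
        exact hup y hy _ hlt.le
      simp at h0
  · rw [Set.not_nonempty_iff_eq_empty.1 hne]
    simp

end Threshold

/-! ### Measurability of one stage -/

theorem measurable_sInf_nat {β : Type*} [MeasurableSpace β] {S : β → Set ℕ}
    (hS : ∀ n, MeasurableSet {b | n ∈ S b}) : Measurable fun b => sInf (S b) := by
  refine measurable_to_countable' fun n => ?_
  have hset : (fun b => sInf (S b)) ⁻¹' {n}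
      = ({b | n ∈ S b} ∩ ⋂ k ∈ Set.Iio n, {b | k ∈ S b}ᶜ)
        ∪ ((⋂ k, {b | k ∈ S b}ᶜ) ∩ {_b | n = 0}) := by
    ext b
    simp only [Set.mem_preimage, Set.mem_singleton_iff, Set.mem_union, Set.mem_inter_iff,
      Set.mem_iInter, Set.mem_compl_iff, Set.mem_ofPred_eq, Set.mem_Iio]
    constructor
    · intro h
      by_cases hne : (S b).Nonempty
      · exact Or.inl ⟨h ▸ Nat.sInf_mem hne, fun k hk => Nat.notMem_of_lt_sInf (h.symm ▸ hk)⟩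
      · rw [Set.not_nonempty_iff_eq_empty.1 hne] at h ⊢
        rw [Nat.sInf_empty] at h
        exact Or.inr ⟨fun k hk => hk, h.symm⟩
    · rintro (⟨h1, h2⟩ | ⟨h1, h2⟩)
      · refine le_antisymm (Nat.sInf_le h1) ?_
        by_contra! hlt
        exact h2 _ hlt (Nat.sInf_mem ⟨n, h1⟩)
      · rw [Set.eq_empty_of_forall_notMem h1, Nat.sInf_empty, h2]
  rw [hset]
  refine ((hS n).inter (MeasurableSet.biInter (Set.to_countable _) fun k _ => (hS k).compl)).union
    ((MeasurableSet.iInter fun k => (hS k).compl).inter (MeasurableSet.const _))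

namespace Stage

variable {M : ℕ}

theorem measurableSet_success (n : ℕ) : MeasurableSet {s : Stage M | s.Success n} := by
  have : Measurable fun s : Stage M => s.1 n := (measurable_pi_apply n).comp measurable_fst
  exact this (t := {b : Fin M → Bool | ∃! i, b i = true}) (MeasurableSet.of_discrete)

theorem measurable_successPeriod (k : ℕ) :
    Measurable fun s : Stage M => s.successPeriod k := by
  unfold successPeriod
  induction k using Nat.strong_induction_on with
  | _ k ih =>
    simp only [fun s : Stage M => Nat.nth_eq_sInf s.Success k]
    refine measurable_sInf_nat fun n => ?_
    have hset : {s : Stage M | n ∈ {x | s.Success x ∧ ∀ i < k, Nat.nth s.Success i < x}}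
        = {s : Stage M | s.Success n} ∩ ⋂ i ∈ Set.Iio k, {s | Nat.nth s.Success i < n} := by
      ext s
      simp
    rw [hset]
    refine (measurableSet_success n).inter
      (MeasurableSet.biInter (Set.to_countable _) fun i hi => ?_)
    exact ih i hi (measurableSet_Iio (a := n))

theorem measurableSet_wins (k : ℕ) (i : Fin M) : MeasurableSet {s : Stage M | s.Wins k i} := by
  have hset : {s : Stage M | s.Wins k i}
      = ⋃ n, ({s : Stage M | s.successPeriod k = n}
          ∩ ({s : Stage M | s.Success n} ∩ {s : Stage M | s.1 n i = true})) := by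
    ext s
    simp [Wins]
  rw [hset]
  refine MeasurableSet.iUnion fun n => ?_
  refine (measurable_successPeriod k (measurableSet_singleton n)).inter
    ((measurableSet_success n).inter ?_)
  have : Measurable fun s : Stage M => s.1 n i :=
    (measurable_pi_apply i).comp ((measurable_pi_apply n).comp measurable_fst)
  exact this (measurableSet_singleton true)

theorem measurable_X (k : ℕ) : Measurable fun s : Stage M => s.X k :=
  (measurable_pi_apply k).comp (measurable_fst.comp measurable_snd)

theorem measurable_rate (m : ModelI M) (k : ℕ) : Measurable fun s : Stage M => s.rate m k := by
  unfold rate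
  have h1 := measurable_X (M := M) k
  have h2 : Measurable fun s : Stage M => (s.successPeriod k : ℝ) :=
    (measurable_from_top (f := fun n : ℕ => (n : ℝ))).comp (measurable_successPeriod k)
  fun_prop

theorem measurableSet_stopsAt (k : ℕ) :
    MeasurableSet {q : (Fin M → ℝ) × Stage M | q.2.StopsAt q.1 k} := by
  have hset : {q : (Fin M → ℝ) × Stage M | q.2.StopsAt q.1 k}
      = ⋃ i, ({q : (Fin M → ℝ) × Stage M | q.2.Wins k i} ∩ {q | q.1 i ≤ q.2.X k}) := by
    ext q
    simp [StopsAt]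
  rw [hset]
  refine MeasurableSet.iUnion fun i => (measurable_snd (measurableSet_wins k i)).inter ?_
  exact measurableSet_le ((measurable_pi_apply i).comp measurable_fst)
    ((measurable_X k).comp measurable_snd)

theorem measurableSet_exists_stopsAt :
    MeasurableSet {q : (Fin M → ℝ) × Stage M | ∃ k, q.2.StopsAt q.1 k} := by
  rw [Set.ofPred_exists]
  exact MeasurableSet.iUnion measurableSet_stopsAt

theorem measurable_stopEpoch :
    Measurable fun q : (Fin M → ℝ) × Stage M => q.2.stopEpoch q.1 :=
  measurable_sInf_nat measurableSet_stopsAt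

theorem measurable_thresholdReward (m : ModelI M) :
    Measurable fun q : (Fin M → ℝ) × Stage M => q.2.thresholdReward m q.1 := by
  unfold thresholdReward
  refine Measurable.ite measurableSet_exists_stopsAt ?_ measurable_const
  have h : Measurable fun q : (Stage M) × ℕ => q.1.rate m q.2 :=
    measurable_from_prod_countable_left fun k => measurable_rate m k
  exact h.comp (measurable_snd.prodMk measurable_stopEpoch)

theorem measurable_thresholdReward_const (m : ModelI M) (θ : Fin M → ℝ) :
    Measurable fun s : Stage M => s.thresholdReward m θ :=
  (measurable_thresholdReward m).comp (measurable_const.prodMk measurable_id)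

theorem measurable_pick (E : Finset (Fin M)) (hE : E.Nonempty) :
    Measurable fun s : Stage M => s.pick E hE := by
  have : Measurable fun π : Equiv.Perm (Fin M) => π.symm ((E.image π).min' (hE.image _)) :=
    measurable_from_top
  exact this.comp (measurable_snd.comp measurable_snd)

/-! ### The law of one stage -/

variable {m : ModelI M}

theorem measurePreserving_attempts (m : ModelI M) :
    MeasurePreserving (fun s : Stage M => s.1) m.stageLaw
      (Measure.infinitePi fun _ : ℕ =>
        Measure.pi fun i : Fin M => bernoulliMeasure true false (m.p i)) :=
  measurePreserving_fst

theorem measurePreserving_qualities (m : ModelI M) :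
    MeasurePreserving (fun s : Stage M => s.2.1) m.stageLaw
      (Measure.infinitePi fun _ : ℕ => m.law) :=
  measurePreserving_fst.comp (g := Prod.fst) measurePreserving_snd

theorem measurePreserving_X (m : ModelI M) (k : ℕ) :
    MeasurePreserving (fun s : Stage M => s.X k) m.stageLaw m.law :=
  (measurePreserving_eval_infinitePi (fun _ : ℕ => m.law) k).comp (measurePreserving_qualities m)

theorem ae_forall_X {p : ℝ → Prop} (hp : ∀ᵐ x ∂m.law, p x) :
    ∀ᵐ s ∂m.stageLaw, ∀ k, p (s.X k) :=
  ae_all_iff.2 fun k => (measurePreserving_X m k).quasiMeasurePreserving.ae hp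

/-- Almost surely there are infinitely many successful contentions (Borel–Cantelli). -/
theorem ae_infinite_success (hps : 0 < m.ps) :
    ∀ᵐ s ∂m.stageLaw, (Set.ofPred s.Success).Infinite := by
  set ν : Measure (Fin M → Bool) :=
    Measure.pi fun i : Fin M => bernoulliMeasure true false (m.p i) with hν
  set G : Set (Fin M → Bool) := {b | ∃! i, b i = true} with hG
  have hGpos : 0 < ν G := by
    obtain ⟨i, -, hi⟩ : ∃ i ∈ Finset.univ,
        0 < (m.p i : ℝ) * ∏ j ∈ Finset.univ.erase i, (1 - (m.p j : ℝ)) := by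
      by_contra! h
      exact absurd (Finset.sum_nonpos h) (not_le.2 hps)
    have hsub : Set.pi Set.univ (fun j : Fin M => ({decide (j = i)} : Set Bool)) ⊆ G := by
      intro b hb
      have hb' : ∀ j, b j = decide (j = i) := fun j => hb j (Set.mem_univ j)
      exact ⟨i, by simp [hb'], fun j hj => by simpa [hb'] using hj⟩
    refine lt_of_lt_of_le ?_ (measure_mono hsub)
    rw [hν, Measure.pi_pi, pos_iff_ne_zero, Finset.prod_ne_zero_iff]
    intro j _
    have hpi : (m.p i : ℝ) ≠ 0 := fun h => by simp [h] at hi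
    rw [bernoulliMeasure_apply _ (measurableSet_singleton _)]
    by_cases hj : j = i
    · subst hj
      simp [← NNReal.coe_eq_zero, hpi]
    · have h1 : (1 - (m.p j : ℝ)) ≠ 0 := by
        have := Finset.prod_ne_zero_iff.1 (right_ne_zero_of_mul hi.ne') j (by simp [hj])
        exact this
      simp [hj, ← NNReal.coe_eq_zero, h1]
  have hBC : ∀ᵐ a ∂(Measure.infinitePi fun _ : ℕ => ν),
      ∀ N : ℕ, ∃ k, a (N + k) ∈ G := by
    refine ae_all_iff.2 fun N => ?_
    have hshift : MeasurePreserving (fun (a : ℕ → Fin M → Bool) k => a (N + k))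
        (Measure.infinitePi fun _ : ℕ => ν) (Measure.infinitePi fun _ : ℕ => ν) :=
      ⟨by fun_prop, Measure.map_infinitePi_infinitePi_of_inj (add_right_injective N)⟩
    exact hshift.quasiMeasurePreserving.ae
      (ae_exists_mem_of_le_measure (B := fun _ => G) (fun _ => MeasurableSet.of_discrete)
        hGpos fun _ => le_rfl)
  filter_upwards [(measurePreserving_attempts m).quasiMeasurePreserving.ae hBC] with s hs
  refine Set.infinite_of_not_bddAbove ?_
  rintro ⟨N, hN⟩
  obtain ⟨k, hk⟩ := hs (N + 1)
  have : N + 1 + k ≤ N := hN (show N + 1 + k ∈ Set.ofPred s.Success from hk)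
  omega

theorem exists_wins {s : Stage M} (hs : (Set.ofPred s.Success).Infinite) (k : ℕ) :
    ∃ i, s.Wins k i := by
  have h : s.Success (s.successPeriod k) := Nat.nth_mem_of_infinite hs k
  exact ⟨h.choose, h, h.choose_spec.1⟩

theorem ae_exists_stopsAt (hps : 0 < m.ps) {θ : Fin M → ℝ}
    (hθ : ∀ i, 0 < m.law (Set.Ici (θ i))) :
    ∀ᵐ s ∂m.stageLaw, ∃ k, s.StopsAt θ k := by
  have hM : Nonempty (Fin M) := by
    by_contra h
    rw [not_nonempty_iff] at h
    simp [ModelI.ps] at hps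
  obtain ⟨i₀, hi₀⟩ := Finite.exists_max θ
  have hx : ∀ᵐ x ∂(Measure.infinitePi fun _ : ℕ => m.law), ∃ k, x k ∈ Set.Ici (θ i₀) :=
    ae_exists_mem_of_le_measure (fun _ => measurableSet_Ici) (hθ i₀) fun _ => le_rfl
  filter_upwards [ae_infinite_success hps,
    (measurePreserving_qualities m).quasiMeasurePreserving.ae hx] with s hs ⟨k, hk⟩
  obtain ⟨i, hi⟩ := exists_wins hs k
  exact ⟨k, i, hi, (hi₀ i).trans hk⟩

open scoped ENNReal

open Classical in
/-- A likelihood-type product over the qualities that the users in `J` see in an exploitation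
stage has mean at most one. -/
theorem lintegral_prod_exploit_le_one (hps : 0 < m.ps) {θ : Fin M → ℝ}
    (hθ : ∀ i, 0 < m.law (Set.Ici (θ i))) (J : Finset (Fin M)) {φ : ℝ → ℝ≥0∞}
    (hφ : Measurable φ) (h1 : ∫⁻ x, φ x ∂m.law ≤ 1) :
    ∫⁻ s, (if ∃ k, s.StopsAt θ k then
        ∏ k ∈ (Finset.range (s.stopEpoch θ + 1)).filter (fun k => ∃ j ∈ J, s.Wins k j),
          φ (s.X k) else 1) ∂m.stageLaw ≤ 1 := by
  have hae : ∀ᵐ s ∂m.stageLaw, (if ∃ k, s.StopsAt θ k then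
        ∏ k ∈ (Finset.range (s.stopEpoch θ + 1)).filter (fun k => ∃ j ∈ J, s.Wins k j),
          φ (s.X k) else 1)
      = (if ∃ k, s.StopsAt θ k then
        ∏ k ∈ (Finset.range (s.stopEpoch θ + 1)).filter (fun k => ∃ j ∈ J, s.Wins k j),
          φ (s.X k) else 0) := by
    filter_upwards [ae_exists_stopsAt hps hθ] with s hs
    rw [if_pos hs, if_pos hs]
  rw [lintegral_congr_ae hae]
  refine (lintegral_prod_le _).trans ?_
  refine (lintegral_mono (g := fun _ => 1) fun a => ?_).trans (by simp)
  refine (lintegral_prod_le _).trans ?_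
  -- the attempts `a` are fixed: the winners are known, the qualities are IID
  set a' : Stage M := (a, 0, 1)
  have hB : ∀ k, MeasurableSet {y : ℝ | ∃ i, a'.Wins k i ∧ θ i ≤ y} := by
    intro k
    have : {y : ℝ | ∃ i, a'.Wins k i ∧ θ i ≤ y}
        = ⋃ i ∈ {i | a'.Wins k i}, Set.Ici (θ i) := by
      ext y
      simp
    rw [this]
    exact MeasurableSet.biUnion (Set.to_countable _) fun _ _ => measurableSet_Ici
  refine le_trans (le_of_eq ?_) (lintegral_stopped_prod_le_one (μ := m.law) hB
    (ψ := fun k => if ∃ j ∈ J, a'.Wins k j then φ else fun _ => 1) (fun k => ?_) fun k => ?_)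
  · refine lintegral_congr fun x => ?_
    refine (lintegral_congr fun π => ?_).trans
      ((lintegral_const _).trans (by rw [measure_univ, mul_one]))
    rw [Finset.prod_filter]
    refine if_congr Iff.rfl (Finset.prod_congr rfl fun k _ => ?_) rfl
    rw [apply_ite (fun f : ℝ → ℝ≥0∞ => f (x k))]
    rfl
  · split_ifs
    · exact hφ
    · exact measurable_const
  · split_ifs
    · exact h1
    · simp

/-- The same for an exploration stage: the exploring user is chosen independently of the quality
at the first successful contention. -/
theorem lintegral_explore_le_one (E : Finset (Fin M)) (hE : E.Nonempty) (J : Finset (Fin M))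
    {φ : ℝ → ℝ≥0∞} (hφ : Measurable φ) (h1 : ∫⁻ x, φ x ∂m.law ≤ 1) :
    ∫⁻ s, (if s.pick E hE ∈ J then φ (s.X 0) else 1) ∂m.stageLaw ≤ 1 := by
  refine (lintegral_prod_le _).trans ?_
  refine (lintegral_mono (g := fun _ => 1) fun a => ?_).trans (by simp)
  have hm : Measurable fun q : (ℕ → ℝ) × Equiv.Perm (Fin M) =>
      if Stage.pick (a, q) E hE ∈ J then φ (Stage.X (a, q) 0) else 1 := by
    have ha : Measurable fun q : (ℕ → ℝ) × Equiv.Perm (Fin M) => ((a, q) : Stage M) :=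
      measurable_prodMk_left
    refine Measurable.ite ?_ (hφ.comp ((measurable_X 0).comp ha)) measurable_const
    exact (measurable_pick E hE).comp ha (t := {i | i ∈ J}) MeasurableSet.of_discrete
  simp only
  rw [lintegral_prod_symm _ hm.aemeasurable]
  refine (lintegral_mono (g := fun _ => 1) fun π => ?_).trans (by simp)
  set i := Stage.pick ((a, 0, π) : Stage M) E hE
  change ∫⁻ x : ℕ → ℝ, (if i ∈ J then φ (x 0) else 1) ∂(Measure.infinitePi fun _ => m.law) ≤ 1
  split_ifs
  · rw [(measurePreserving_eval_infinitePi (fun _ : ℕ => m.law) 0).lintegral_comp hφ]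
    exact h1
  · simp

/-! ### Rewards in one stage -/

theorem abs_rate_le (hζ : 0 < m.ζ) (hK : 0 < m.K) {B : ℝ} {s : Stage M}
    {k : ℕ} (hB : |s.X k| ≤ B) : |s.rate m k| ≤ B := by
  have hden : 0 < m.ζ * ((s.successPeriod k : ℝ) + 1) + m.K := by positivity
  rw [rate, abs_div, abs_mul, abs_of_pos hK, abs_of_pos hden, div_le_iff₀ hden]
  have h0 : 0 ≤ B := (abs_nonneg _).trans hB
  have h1 : 0 ≤ m.ζ * ((s.successPeriod k : ℝ) + 1) := by positivity
  calc |s.X k| * m.K ≤ B * m.K := by gcongr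
    _ ≤ B * (m.ζ * ((s.successPeriod k : ℝ) + 1) + m.K) := by gcongr; linarith

theorem abs_thresholdReward_le (hζ : 0 < m.ζ) (hK : 0 < m.K) {B : ℝ} {s : Stage M}
    (hB : ∀ k, |s.X k| ≤ B) (θ : Fin M → ℝ) : |s.thresholdReward m θ| ≤ B := by
  unfold thresholdReward
  split_ifs
  · exact abs_rate_le hζ hK (hB _)
  · simpa using (abs_nonneg _).trans (hB 0)

/-- If a nonnegative threshold rule stops, it gains at most the range of the qualities over
transmitting at the first successful contention, since it cannot spend less time on contention. -/
theorem thresholdReward_sub_rate_zero_le (hζ : 0 < m.ζ) (hK : 0 < m.K) {a b u : ℝ} {s : Stage M}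
    (hs : (Set.ofPred s.Success).Infinite) (ha : ∀ k, a ≤ s.X k) (hb : ∀ k, s.X k ≤ b)
    (hu : 0 ≤ u) (hstops : ∃ k, s.StopsAt (fun _ => u) k) :
    s.thresholdReward m (fun _ => u) - s.rate m 0 ≤ b - a := by
  unfold thresholdReward
  rw [if_pos hstops]
  set τ := s.stopEpoch fun _ => u
  obtain ⟨i, -, hτ⟩ : s.StopsAt (fun _ => u) τ := Nat.sInf_mem (s := {k | s.StopsAt _ k}) hstops
  have hX : 0 ≤ s.X τ := hu.trans hτ
  have ht : (s.successPeriod 0 : ℝ) ≤ s.successPeriod τ :=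
    Nat.cast_le.2 (Nat.nth_monotone hs (Nat.zero_le τ))
  have hden : 0 < m.ζ * ((s.successPeriod 0 : ℝ) + 1) + m.K := by positivity
  have h1 : s.rate m τ ≤ s.X τ * m.K / (m.ζ * ((s.successPeriod 0 : ℝ) + 1) + m.K) := by
    unfold rate
    gcongr
  have hab : 0 ≤ b - a := sub_nonneg.2 ((ha 0).trans (hb 0))
  calc s.rate m τ - s.rate m 0
      ≤ s.X τ * m.K / (m.ζ * ((s.successPeriod 0 : ℝ) + 1) + m.K) - s.rate m 0 := by gcongr
    _ = (s.X τ - s.X 0) * m.K / (m.ζ * ((s.successPeriod 0 : ℝ) + 1) + m.K) := by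
        unfold rate
        ring
    _ ≤ b - a := by
        rw [div_le_iff₀ hden]
        have h2 : 0 ≤ m.ζ * ((s.successPeriod 0 : ℝ) + 1) := by positivity
        calc (s.X τ - s.X 0) * m.K ≤ (b - a) * m.K := by
              gcongr
              · exact hb τ
              · exact ha 0
          _ ≤ (b - a) * (m.ζ * ((s.successPeriod 0 : ℝ) + 1) + m.K) := by
              gcongr
              linarith

/-- Two threshold rules whose thresholds are all within `ε` of `u` can differ only if the first
quality that is at least `u - ε` is below `u + ε`. -/
theorem thresholdReward_eq_of_near {u ε : ℝ} {θ θ' : Fin M → ℝ} {s : Stage M}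
    (hs : (Set.ofPred s.Success).Infinite) (hθ : ∀ i, |θ i - u| ≤ ε) (hθ' : ∀ i, |θ' i - u| ≤ ε)
    (h : ¬ ∃ k, (∀ i < k, s.X i ∈ Set.Iio (u - ε)) ∧ s.X k ∈ Set.Ico (u - ε) (u + ε)) :
    s.thresholdReward m θ = s.thresholdReward m θ' := by
  have hno : ∀ {η : Fin M → ℝ}, (∀ i, |η i - u| ≤ ε) → ∀ k, s.X k < u - ε →
      ¬ s.StopsAt η k := by
    rintro η hη k hk ⟨i, -, hi⟩
    have := (abs_le.1 (hη i)).1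
    linarith
  by_cases hex : ∃ k, u - ε ≤ s.X k
  · classical
    set k := Nat.find hex
    have hk : u - ε ≤ s.X k := Nat.find_spec hex
    have hlt : ∀ i < k, s.X i < u - ε := fun i hi => not_le.1 (Nat.find_min hex hi)
    have hbig : u + ε ≤ s.X k := by
      by_contra! hlt'
      exact h ⟨k, hlt, hk, hlt'⟩
    obtain ⟨w, hw⟩ := exists_wins hs k
    have key : ∀ {η : Fin M → ℝ}, (∀ i, |η i - u| ≤ ε) →
        s.thresholdReward m η = s.rate m k := by
      intro η hη
      have hstops : s.StopsAt η k := ⟨w, hw, by linarith [(abs_le.1 (hη w)).2]⟩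
      have hτ : s.stopEpoch η = k := by
        refine le_antisymm (Nat.sInf_le hstops) ?_
        by_contra! hlt'
        exact hno hη _ (hlt _ hlt') (Nat.sInf_mem (s := {k | s.StopsAt η k}) ⟨k, hstops⟩)
      rw [thresholdReward, if_pos ⟨k, hstops⟩, hτ]
    rw [key hθ, key hθ']
  · push Not at hex
    have key : ∀ {η : Fin M → ℝ}, (∀ i, |η i - u| ≤ ε) → s.thresholdReward m η = 0 := by
      intro η hη
      rw [thresholdReward, if_neg]
      rintro ⟨k, hk⟩
      exact hno hη k (hex k) hk
    rw [key hθ, key hθ']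

theorem measure_thresholdReward_ne_le (hps : 0 < m.ps) {u ε : ℝ} {θ θ' : Fin M → ℝ}
    (hθ : ∀ i, |θ i - u| ≤ ε) (hθ' : ∀ i, |θ' i - u| ≤ ε) :
    m.stageLaw {s | s.thresholdReward m θ ≠ s.thresholdReward m θ'}
      ≤ (m.law (Set.Ici (u - ε)))⁻¹ * m.law (Set.Ico (u - ε) (u + ε)) := by
  set N : Set (ℕ → ℝ) :=
    {x | ∃ k, (∀ i < k, x i ∈ Set.Iio (u - ε)) ∧ x k ∈ Set.Ico (u - ε) (u + ε)} with hN
  have hle : m.stageLaw {s | s.thresholdReward m θ ≠ s.thresholdReward m θ'}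
      ≤ m.stageLaw ((fun s : Stage M => s.2.1) ⁻¹' N) := by
    refine measure_mono_ae ?_
    filter_upwards [ae_infinite_success hps] with s hs hne
    by_contra hnot
    exact hne (thresholdReward_eq_of_near hs hθ hθ' hnot)
  have hNm : MeasurableSet N := by
    have : N = ⋃ k, ((⋂ i ∈ Set.Iio k, {x : ℕ → ℝ | x i ∈ Set.Iio (u - ε)})
        ∩ {x | x k ∈ Set.Ico (u - ε) (u + ε)}) := by
      ext x
      simp [hN]
    rw [this]
    exact MeasurableSet.iUnion fun k => (MeasurableSet.biInter (Set.to_countable _) fun i _ =>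
      measurable_pi_apply i measurableSet_Iio).inter (measurable_pi_apply k measurableSet_Ico)
  rw [(measurePreserving_qualities m).measure_preimage hNm.nullMeasurableSet] at hle
  refine hle.trans ?_
  have h := measure_first_exit_le (μ := m.law) (A := Set.Iio (u - ε)) measurableSet_Iio
    (C := Set.Ico (u - ε) (u + ε)) measurableSet_Ico
  rwa [Set.compl_Iio] at h

end Stage

namespace OnlineMU

open scoped ENNReal

variable {M : ℕ} {m : ModelI M} {share : Fin M → Finset (Fin M)} {L z : ℝ}

/-! ### Empirical thresholds -/

theorem isProbabilityMeasure_empirical {I : Finset (ℕ × ℕ)} (hI : I.Nonempty)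
    (ω : ℕ → Stage M) : IsProbabilityMeasure (empirical I ω) := by
  refine ⟨?_⟩
  have h0 : (I.card : ℝ≥0∞) ≠ 0 := by simpa using hI.ne_empty
  simp only [empirical, Measure.smul_apply, Measure.coe_finsetSum, Finset.sum_apply, measure_univ,
    Finset.sum_const, nsmul_eq_mul, mul_one, smul_eq_mul]
  exact ENNReal.inv_mul_cancel h0 (by simp)

theorem integrable_empirical (I : Finset (ℕ × ℕ)) (hI : I.Nonempty) (ω : ℕ → Stage M)
    (f : ℝ → ℝ) : Integrable f (empirical I ω) := by
  refine Integrable.smul_measure ?_ (by simpa using hI.ne_empty)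
  exact integrable_finsetSum_measure.2 fun i _ => integrable_dirac (by simp)

theorem integral_empirical (I : Finset (ℕ × ℕ)) (ω : ℕ → Stage M) (f : ℝ → ℝ) :
    ∫ x, f x ∂(empirical I ω) = (I.card : ℝ)⁻¹ * ∑ i ∈ I, f ((ω i.1).X i.2) := by
  rw [empirical, integral_smul_measure,
    integral_finsetSum_measure fun i _ => integrable_dirac (by simp)]
  simp

theorem empirical_congr {I : Finset (ℕ × ℕ)} {ω ω' : ℕ → Stage M}
    (h : ∀ i ∈ I, ω i.1 = ω' i.1) : empirical I ω = empirical I ω' := by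
  unfold empirical
  rw [Finset.sum_congr rfl fun i hi => by rw [h i hi]]

theorem le_threshold_empirical_iff {c : ℝ} (hc : 0 < c) {I : Finset (ℕ × ℕ)} (hI : I.Nonempty)
    (ω : ℕ → Stage M) (u : ℝ) :
    u ≤ threshold c (empirical I ω)
      ↔ c * u ≤ (I.card : ℝ)⁻¹ * ∑ i ∈ I, max ((ω i.1).X i.2 - u) 0 := by
  have := isProbabilityMeasure_empirical hI ω
  rw [le_threshold_iff hc (integrable_empirical I hI ω _), integral_empirical]

theorem measurable_sample (i : ℕ × ℕ) : Measurable fun ω : ℕ → Stage M => (ω i.1).X i.2 :=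
  (Stage.measurable_X i.2).comp (measurable_pi_apply i.1)

theorem measurable_threshold_empirical {c : ℝ} (hc : 0 < c) (I : Finset (ℕ × ℕ)) :
    Measurable fun ω : ℕ → Stage M => threshold c (empirical I ω) := by
  rcases I.eq_empty_or_nonempty with rfl | hI
  · simp only [empirical, Finset.sum_empty, smul_zero]
    exact measurable_const
  · refine measurable_of_Ici fun u => ?_
    simp only [Set.preimage, Set.mem_Ici, le_threshold_empirical_iff hc hI]
    refine measurableSet_le measurable_const (measurable_const.mul
      (Finset.measurable_fun_sum _ fun i _ => ?_))
    exact ((measurable_sample i).sub_const u).max measurable_const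

/-- An estimated threshold does not lie beyond the support of the law: it lies below `0` or below one of
the samples. -/
theorem measure_Ici_threshold_empirical_pos {c : ℝ} (hc : 0 < c) (hmean : 0 < ∫ x, x ∂m.law)
    {I : Finset (ℕ × ℕ)} (hI : I.Nonempty) {ω : ℕ → Stage M}
    (hω : ∀ l k, 0 < m.law (Set.Ici ((ω l).X k))) :
    0 < m.law (Set.Ici (threshold c (empirical I ω))) := by
  set θ := threshold c (empirical I ω) with hθ
  rcases le_or_gt θ 0 with h0 | h0
  · refine lt_of_lt_of_le ?_ (measure_mono (Set.Ici_subset_Ici.2 h0))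
    refine pos_iff_ne_zero.2 fun h => ?_
    have hneg : ∀ᵐ x ∂m.law, x ≤ 0 := by
      filter_upwards [measure_eq_zero_iff_ae_notMem.1 h] with x hx
      exact (not_le.1 hx).le
    exact absurd (integral_nonpos_of_ae hneg) (not_le.2 hmean)
  · have h1 := (le_threshold_empirical_iff hc hI ω θ).1 le_rfl
    have hcard : (0 : ℝ) < I.card := by exact_mod_cast hI.card_pos
    have h2 : 0 < ∑ i ∈ I, max ((ω i.1).X i.2 - θ) 0 := by
      by_contra! hle
      have : (I.card : ℝ)⁻¹ * ∑ i ∈ I, max ((ω i.1).X i.2 - θ) 0 ≤ 0 :=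
        mul_nonpos_of_nonneg_of_nonpos (by positivity) hle
      have : 0 < c * θ := by positivity
      linarith
    obtain ⟨i, -, hi⟩ := Finset.exists_lt_of_sum_lt (s := I) (f := fun _ => (0 : ℝ))
      (by simpa using h2)
    have hlt : θ ≤ (ω i.1).X i.2 := by
      by_contra! hlt
      rw [max_eq_right (by linarith)] at hi
      exact lt_irrefl _ hi
    exact (hω i.1 i.2).trans_le (measure_mono (Set.Ici_subset_Ici.2 hlt))

/-! ### The memory of the algorithm -/

theorem obs_fst_le (ω : ℕ → Stage M) (l : ℕ) :
    ∀ j, ∀ i ∈ (memory m share L z ω l).obs j, i.1 ≤ l := by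
  classical
  induction l with
  | zero =>
    intro j i hi
    simp only [memory, init, Finset.mem_singleton] at hi
    simp [hi]
  | succ l ih =>
    intro j i hi
    have ih' := fun h => (ih j i h).trans (Nat.le_succ l)
    simp only [memory, update] at hi
    split_ifs at hi with h1 h2
    · simp only at hi
      split_ifs at hi
      · rcases Finset.mem_insert.1 hi with rfl | hi
        · exact le_rfl
        · exact ih' hi
      · exact ih' hi
    · rcases Finset.mem_union.1 hi with hi | hi
      · exact ih' hi
      · obtain ⟨k, -, rfl⟩ := Finset.mem_image.1 hi
        exact le_rfl
    · exact ih' hi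

theorem one_le_count (ω : ℕ → Stage M) (l : ℕ) (j : Fin M) :
    1 ≤ (memory m share L z ω l).count j := by
  classical
  induction l with
  | zero => simp [memory, init]
  | succ l ih =>
    simp only [memory, update]
    split_ifs with h1 h2
    · simp only
      split_ifs <;> omega
    · simp only
      split_ifs <;> omega
    · exact ih

/-- Every access of a user is accompanied by an observation of that user. -/
theorem count_le_card_obs (ω : ℕ → Stage M) (l : ℕ) (j : Fin M) :
    (memory m share L z ω l).count j ≤ ((memory m share L z ω l).obs j).card := by
  classical
  induction l with
  | zero => simp [memory, init]
  | succ l ih =>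
    have hnot : ∀ k, (l + 1, k) ∉ (memory m share L z ω l).obs j := fun k hk => by
      have := obs_fst_le ω l j _ hk
      simp only at this
      omega
    simp only [memory, update]
    split_ifs with h1 h2
    · simp only
      split_ifs
      · rw [Finset.card_insert_of_notMem (hnot 0)]
        omega
      · exact ih
    · simp only
      split_ifs with hw
      · set τ := (ω (l + 1)).stopEpoch (estThreshold m share (memory m share L z ω l) ω)
        have hsub : insert (l + 1, τ) ((memory m share L z ω l).obs j)
            ⊆ (memory m share L z ω l).obs j ∪
              ((Finset.range (τ + 1)).filter fun k => (ω (l + 1)).Wins k j).image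
                fun k => (l + 1, k) := by
          refine Finset.insert_subset ?_ Finset.subset_union_left
          refine Finset.mem_union_right _ (Finset.mem_image.2 ⟨τ, ?_, rfl⟩)
          simp [hw]
        have := Finset.card_le_card hsub
        rw [Finset.card_insert_of_notMem (hnot τ)] at this
        refine le_trans ?_ (this.trans (le_of_eq ?_))
        · omega
        · congr!
      · exact ih.trans (Finset.card_le_card Finset.subset_union_left)
    · exact ih

open Classical in
/-- The set of all samples that user `j` uses. -/
def samples (share : Fin M → Finset (Fin M)) (S : Memory M) (j : Fin M) : Finset (ℕ × ℕ) :=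
  (share j).biUnion S.obs

theorem count_le_card_samples (hshare : ∀ j, j ∈ share j) (ω : ℕ → Stage M) (l : ℕ) (j : Fin M) :
    (memory m share L z ω l).count j ≤ (samples share (memory m share L z ω l) j).card :=
  (count_le_card_obs ω l j).trans
    (Finset.card_le_card (Finset.subset_biUnion_of_mem (memory m share L z ω l).obs (hshare j)))

theorem samples_nonempty (hshare : ∀ j, j ∈ share j) (ω : ℕ → Stage M) (l : ℕ) (j : Fin M) :
    (samples share (memory m share L z ω l) j).Nonempty :=
  Finset.card_pos.1 ((one_le_count ω l j).trans (count_le_card_samples hshare ω l j))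

theorem estThreshold_congr {S : Memory M} {ω ω' : ℕ → Stage M}
    (h : ∀ j, ∀ i ∈ S.obs j, ω i.1 = ω' i.1) :
    estThreshold m share S ω = estThreshold m share S ω' := by
  classical
  funext j
  unfold estThreshold
  rw [empirical_congr fun i hi => ?_]
  obtain ⟨j', -, hj'⟩ := Finset.mem_biUnion.1 hi
  exact h j' i hj'

/-- The memory after stage `l` depends on the stages up to `l` only. -/
theorem memory_congr {ω ω' : ℕ → Stage M} (l : ℕ) (h : ∀ n ≤ l, ω n = ω' n) :
    memory m share L z ω l = memory m share L z ω' l := by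
  induction l with
  | zero => rfl
  | succ l ih =>
    have ih' := ih fun n hn => h n (hn.trans (Nat.le_succ l))
    have hθ : estThreshold m share (memory m share L z ω' l) ω
        = estThreshold m share (memory m share L z ω' l) ω' :=
      estThreshold_congr fun j i hi => h _ ((obs_fst_le ω' l j i hi).trans (Nat.le_succ l))
    change update m share L z ω (l + 1) (memory m share L z ω l)
      = update m share L z ω' (l + 1) (memory m share L z ω' l)
    rw [ih']
    simp only [update]
    rw [hθ, h (l + 1) le_rfl]

theorem memory_update (ω : ℕ → Stage M) {l n : ℕ} (h : n < l) (s : Stage M) :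
    memory m share L z (Function.update ω l s) n = memory m share L z ω n :=
  memory_congr n fun k hk => Function.update_of_ne (by omega) _ _

theorem estThreshold_update (ω : ℕ → Stage M) {l n : ℕ} (h : n < l) (s : Stage M) :
    estThreshold m share (memory m share L z ω n) (Function.update ω l s)
      = estThreshold m share (memory m share L z ω n) ω :=
  estThreshold_congr fun j i hi =>
    Function.update_of_ne (by have := obs_fst_le ω n j i hi; omega) _ _

/-! ### Measurability of the memory -/

instance : MeasurableSpace (Memory M) := ⊤

instance : DiscreteMeasurableSpace (Memory M) := ⟨fun _ => trivial⟩

instance : Countable (Memory M) :=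
  Function.Injective.countable (f := fun S : Memory M => (S.count, S.obs)) fun S S' h => by
    cases S
    cases S'
    simpa using h

theorem measurable_to_memory {β : Type*} [MeasurableSpace β] {f : β → Memory M}
    (h1 : ∀ j, Measurable fun b => (f b).count j)
    (h2 : ∀ j i, MeasurableSet {b | i ∈ (f b).obs j}) : Measurable f := by
  refine measurable_to_countable' fun S => ?_
  have hset : f ⁻¹' {S} = (⋂ j, {b | (f b).count j = S.count j})
      ∩ ⋂ j, ⋂ i, {b | i ∈ (f b).obs j ↔ i ∈ S.obs j} := by
    ext b
    simp only [Set.mem_preimage, Set.mem_singleton_iff, Set.mem_inter_iff, Set.mem_iInter,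
      Set.mem_ofPred_eq]
    constructor
    · rintro rfl
      simp
    · rintro ⟨hc, ho⟩
      have hc' : (f b).count = S.count := funext hc
      have ho' : (f b).obs = S.obs := funext fun j => Finset.ext (ho j)
      cases hfb : f b
      cases S
      simp_all
  rw [hset]
  refine (MeasurableSet.iInter fun j => h1 j (measurableSet_singleton _)).inter
    (MeasurableSet.iInter fun j => MeasurableSet.iInter fun i => ?_)
  by_cases hi : i ∈ S.obs j
  · simpa [hi] using h2 j i
  · simp only [hi, iff_false]
    exact (h2 j i).compl

theorem measurable_estThreshold (hc : 0 < m.ζ / (m.ps * m.K)) (S : Memory M) :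
    Measurable fun ω => estThreshold m share S ω :=
  measurable_pi_lambda _ fun _ => measurable_threshold_empirical hc _

theorem measurable_update (hc : 0 < m.ζ / (m.ps * m.K)) (l : ℕ) (S : Memory M) :
    Measurable fun ω => update m share L z ω l S := by
  classical
  have hev : Measurable fun ω : ℕ → Stage M => ω l := measurable_pi_apply l
  by_cases hE : (explore L z l S).Nonempty
  · simp only [update, dif_pos hE]
    exact (measurable_from_top (f := fun i : Fin M => ({
      count := fun j => if j = i then S.count j + 1 else S.count j
      obs := fun j => if j = i then insert (l, 0) (S.obs j) else S.obs j } : Memory M))).comp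
      ((Stage.measurable_pick _ hE).comp hev)
  · simp only [update, dif_neg hE]
    have hq : Measurable fun ω : ℕ → Stage M => (estThreshold m share S ω, ω l) :=
      (measurable_estThreshold hc S).prodMk hev
    have hτ := Stage.measurable_stopEpoch.comp hq
    refine Measurable.ite (hq Stage.measurableSet_exists_stopsAt) ?_ measurable_const
    refine measurable_to_memory (fun j => ?_) fun j i => ?_
    · have hw : MeasurableSet {ω : ℕ → Stage M |
          (ω l).Wins ((ω l).stopEpoch (estThreshold m share S ω)) j} := by
        have : {ω : ℕ → Stage M | (ω l).Wins ((ω l).stopEpoch (estThreshold m share S ω)) j}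
            = ⋃ n, ({ω | (ω l).stopEpoch (estThreshold m share S ω) = n}
              ∩ {ω | (ω l).Wins n j}) := by
          ext ω
          simp
        rw [this]
        exact MeasurableSet.iUnion fun n => (hτ (measurableSet_singleton n)).inter
          (hev (Stage.measurableSet_wins n j))
      exact Measurable.ite hw measurable_const measurable_const
    · have hset : {ω : ℕ → Stage M | i ∈ S.obs j ∪ ((Finset.range
            ((ω l).stopEpoch (estThreshold m share S ω) + 1)).filter
              fun k => (ω l).Wins k j).image fun k => (l, k)}
          = {_ω | i ∈ S.obs j} ∪ ({_ω | i.1 = l}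
            ∩ ({ω | i.2 ≤ (ω l).stopEpoch (estThreshold m share S ω)}
              ∩ {ω | (ω l).Wins i.2 j})) := by
        ext ω
        simp only [Finset.mem_union, Finset.mem_image, Finset.mem_filter, Finset.mem_range,
          Set.mem_union, Set.mem_inter_iff, Set.mem_ofPred_eq, Nat.lt_succ_iff]
        refine or_congr Iff.rfl ⟨?_, ?_⟩
        · rintro ⟨k, ⟨h1, h2⟩, rfl⟩
          exact ⟨rfl, h1, h2⟩
        · rintro ⟨h0, h1, h2⟩
          exact ⟨i.2, ⟨h1, h2⟩, Prod.ext h0.symm rfl⟩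
      have hm : MeasurableSet {ω : ℕ → Stage M | i ∈ S.obs j ∪ ((Finset.range
            ((ω l).stopEpoch (estThreshold m share S ω) + 1)).filter
              fun k => (ω l).Wins k j).image fun k => (l, k)} := by
        rw [hset]
        exact (MeasurableSet.const _).union ((MeasurableSet.const _).inter
          ((hτ (measurableSet_Ici (a := i.2))).inter (hev (Stage.measurableSet_wins i.2 j))))
      convert hm

theorem measurable_apply_countable {β γ δ : Type*} [MeasurableSpace β] [MeasurableSpace γ]
    [MeasurableSpace δ] [Countable γ] [MeasurableSingletonClass γ] {F : β → γ → δ}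
    (hF : ∀ c, Measurable fun b => F b c) {g : β → γ} (hg : Measurable g) :
    Measurable fun b => F b (g b) :=
  (measurable_from_prod_countable_left (f := fun q : β × γ => F q.1 q.2) hF).comp
    (measurable_id.prodMk hg)

theorem measurable_memory (hc : 0 < m.ζ / (m.ps * m.K)) (l : ℕ) :
    Measurable fun ω => memory m share L z ω l := by
  induction l with
  | zero => exact measurable_const
  | succ l ih =>
    exact measurable_apply_countable (F := fun ω S => update m share L z ω (l + 1) S)
      (measurable_update hc (l + 1)) ih

theorem measurable_estThreshold_memory (hc : 0 < m.ζ / (m.ps * m.K)) (l : ℕ) :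
    Measurable fun ω => estThreshold m share (memory m share L z ω l) ω :=
  measurable_apply_countable (F := fun ω S => estThreshold m share S ω)
    (measurable_estThreshold hc) (measurable_memory hc l)

theorem measurableSet_explore (hc : 0 < m.ζ / (m.ps * m.K)) (l n : ℕ) :
    MeasurableSet {ω | (explore L z l (memory m share L z ω n)).Nonempty} :=
  measurable_memory hc n (t := {S | (explore L z l S).Nonempty}) MeasurableSet.of_discrete

theorem measurable_reward (hc : 0 < m.ζ / (m.ps * m.K)) (l : ℕ) :
    Measurable fun ω => reward m share L z l ω := by
  unfold reward
  refine Measurable.ite (measurableSet_explore hc l (l - 1))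
    ((Stage.measurable_rate m 0).comp (measurable_pi_apply l)) ?_
  exact (Stage.measurable_thresholdReward m).comp
    ((measurable_estThreshold_memory hc (l - 1)).prodMk (measurable_pi_apply l))

/-! ### The number of exploration stages -/

open Classical in
/-- The truncated counts `min n_j N` add up to at most `M N`, and every exploration stage
increases their sum by one, provided that `N` bounds the exploration function. -/
theorem sum_explore_add_le (ω : ℕ → Stage M) {H N : ℕ}
    (hN : ∀ l, 1 ≤ l → l ≤ H → D₁ L z l ≤ N) {h : ℕ} (hh : h ≤ H) :
    ∑ l ∈ Finset.Icc 1 h,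
        (if (explore L z l (memory m share L z ω (l - 1))).Nonempty then 1 else 0)
      + ∑ _j : Fin M, min 1 N ≤ ∑ j, min ((memory m share L z ω h).count j) N := by
  induction h with
  | zero => simp [memory, init]
  | succ h ih =>
    have ih' := ih (by omega)
    rw [Finset.sum_Icc_succ_top (by omega), Nat.add_sub_cancel]
    simp only [memory]
    set S := memory m share L z ω h
    simp only [update]
    split_ifs with h1 h2
    · set i := (ω (h + 1)).pick _ h1
      have hi : i ∈ explore L z (h + 1) S := by
        obtain ⟨a, ha, hai⟩ := Finset.mem_image.1
          (Finset.min'_mem ((explore L z (h + 1) S).image (ω (h + 1)).2.2) (h1.image _))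
        have : i = a := by
          simp only [i, Stage.pick]
          rw [← hai, Equiv.symm_apply_apply]
        exact this ▸ ha
      have hlt : S.count i < N := by
        have h3 : (S.count i : ℝ) < D₁ L z (h + 1) := (Finset.mem_filter.1 hi).2
        exact_mod_cast h3.trans_le (hN (h + 1) (by omega) hh)
      have hsum : ∑ j, min (S.count j) N + 1
          ≤ ∑ j, min (if j = i then S.count j + 1 else S.count j) N := by
        rw [← Finset.add_sum_erase _ (fun j => min (S.count j) N) (Finset.mem_univ i),
          ← Finset.add_sum_erase _ (fun j => min (if j = i then S.count j + 1 else S.count j) N)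
            (Finset.mem_univ i)]
        have : ∑ j ∈ Finset.univ.erase i, min (if j = i then S.count j + 1 else S.count j) N
            = ∑ j ∈ Finset.univ.erase i, min (S.count j) N :=
          Finset.sum_congr rfl fun j hj => by rw [if_neg (Finset.ne_of_mem_erase hj)]
        rw [this, if_pos rfl]
        omega
      simp only
      omega
    · refine le_trans (by simpa using ih') (Finset.sum_le_sum fun j _ => ?_)
      simp only
      split_ifs <;> omega
    · simpa using ih'

theorem D₁_mono (hL : 0 ≤ L) (hz : 0 ≤ z) {l H : ℕ} (hl : 1 ≤ l) (hlH : l ≤ H) :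
    D₁ L z l ≤ D₁ L z H := by
  have h1 : (1 : ℝ) ≤ l := by exact_mod_cast hl
  have h2 : (l : ℝ) ≤ H := by exact_mod_cast hlH
  unfold D₁
  have := Real.log_nonneg h1
  gcongr

open Classical in
theorem sum_explore_le (hL : 0 ≤ L) (hz : 0 ≤ z) (ω : ℕ → Stage M) (H : ℕ) :
    ∑ l ∈ Finset.Icc 1 H,
        (if (explore L z l (memory m share L z ω (l - 1))).Nonempty then (1 : ℝ) else 0)
      ≤ M * D₁ L z H := by
  have hD0 : 0 ≤ D₁ L z H := by
    unfold D₁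
    have := Real.log_natCast_nonneg H
    positivity
  set N := ⌈D₁ L z H⌉₊ with hN
  have hbound := sum_explore_add_le (m := m) (share := share) (L := L) (z := z) ω (H := H) (N := N)
    (fun l h1 h2 => (D₁_mono hL hz h1 h2).trans (Nat.le_ceil _)) le_rfl
  set e := ∑ l ∈ Finset.Icc 1 H,
    (if (explore L z l (memory m share L z ω (l - 1))).Nonempty then 1 else 0) with he
  have hcast : ∑ l ∈ Finset.Icc 1 H,
      (if (explore L z l (memory m share L z ω (l - 1))).Nonempty then (1 : ℝ) else 0) = e := by
    rw [he]
    push_cast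
    rfl
  rw [hcast]
  have h2 : ∑ j, min ((memory m share L z ω H).count j) N ≤ M * N := by
    refine (Finset.sum_le_sum fun j _ => min_le_right _ N).trans ?_
    simp
  have h3 : ∑ _j : Fin M, min 1 N = M * min 1 N := by simp
  rw [h3] at hbound
  have h4 : (e : ℝ) + M * min 1 (N : ℝ) ≤ M * N := by
    have := hbound.trans h2
    have h5 : ((e + M * min 1 N : ℕ) : ℝ) ≤ ((M * N : ℕ) : ℝ) := by exact_mod_cast this
    push_cast at h5
    exact h5
  have hM : (0 : ℝ) ≤ M := Nat.cast_nonneg M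
  rcases Nat.eq_zero_or_pos N with h0 | hpos
  · rw [h0] at h4
    have : (0 : ℝ) ≤ M * D₁ L z H := by positivity
    have h5 : e = 0 := by simpa using h4
    rw [h5, Nat.cast_zero]
    exact this
  · have h1N : (1 : ℝ) ≤ N := by exact_mod_cast hpos
    rw [min_eq_left h1N] at h4
    have h6 : (N : ℝ) < D₁ L z H + 1 := Nat.ceil_lt_add_one hD0
    nlinarith

end OnlineMU

namespace OnlineMU

open scoped ENNReal

variable {M : ℕ} {m : ModelI M} {share : Fin M → Finset (Fin M)} {L z : ℝ}

/-! ### Concentration of adaptively collected samples -/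

theorem measurePreserving_stage (m : ModelI M) (l : ℕ) :
    MeasurePreserving (fun ω : ℕ → Stage M => ω l) m.P m.stageLaw :=
  measurePreserving_eval_infinitePi (fun _ : ℕ => m.stageLaw) l

/-- Integrating out one stage. -/
theorem lintegral_P_eq (m : ModelI M) (l : ℕ) {G : (ℕ → Stage M) → ℝ≥0∞} (hG : Measurable G) :
    ∫⁻ ω, G ω ∂m.P = ∫⁻ ω, ∫⁻ s, G (Function.update ω l s) ∂m.stageLaw ∂m.P := by
  have h := measurePreserving_update (μ := m.stageLaw) l
  have h2 := h.lintegral_comp hG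
  change ∫⁻ ω, G ω ∂(Measure.infinitePi fun _ : ℕ => m.stageLaw) = _
  rw [← h2]
  exact lintegral_prod _ (hG.comp h.measurable).aemeasurable

theorem ae_forall_sample {p : ℝ → Prop} (hp : ∀ᵐ x ∂m.law, p x) :
    ∀ᵐ ω ∂m.P, ∀ l k, p ((ω l).X k) :=
  ae_all_iff.2 fun l =>
    (measurePreserving_stage m l).quasiMeasurePreserving.ae (Stage.ae_forall_X hp)

open Classical in
/-- The epochs of stage `l` at which a user in `J` records a quality, if `S` is the memory before
the stage and `θ` are the thresholds in case of exploitation. -/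
noncomputable def newEpochs (L z : ℝ) (J : Finset (Fin M))
    (l : ℕ) (S : Memory M) (θ : Fin M → ℝ) (s : Stage M) : Finset ℕ :=
  if hE : (explore L z l S).Nonempty then
    if s.pick (explore L z l S) hE ∈ J then {0} else ∅
  else if ∃ k, s.StopsAt θ k then
    (Finset.range (s.stopEpoch θ + 1)).filter fun k => ∃ j ∈ J, s.Wins k j
  else ∅

open Classical in
theorem biUnion_obs_succ (J : Finset (Fin M)) (ω : ℕ → Stage M) (l : ℕ) :
    J.biUnion (memory m share L z ω (l + 1)).obs
      = J.biUnion (memory m share L z ω l).obs ∪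
        (newEpochs L z J (l + 1) (memory m share L z ω l)
          (estThreshold m share (memory m share L z ω l) ω) (ω (l + 1))).image
            fun k => (l + 1, k) := by
  change J.biUnion (update m share L z ω (l + 1) (memory m share L z ω l)).obs = _
  set S := memory m share L z ω l
  simp only [update, newEpochs]
  split_ifs with h1 h2 h3
  · ext i
    simp only [Finset.mem_biUnion, Finset.mem_union, Finset.image_singleton,
      Finset.mem_singleton]
    constructor
    · rintro ⟨j, hj, hi⟩
      split_ifs at hi
      · rcases Finset.mem_insert.1 hi with hi | hi
        · exact Or.inr hi
        · exact Or.inl ⟨j, hj, hi⟩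
      · exact Or.inl ⟨j, hj, hi⟩
    · rintro (⟨j, hj, hi⟩ | hi)
      · refine ⟨j, hj, ?_⟩
        split_ifs
        · exact Finset.mem_insert_of_mem hi
        · exact hi
      · refine ⟨_, h2, ?_⟩
        rw [if_pos rfl, hi]
        exact Finset.mem_insert_self _ _
  · rw [Finset.image_empty, Finset.union_empty]
    refine Finset.biUnion_congr rfl fun j hj => ?_
    refine if_neg ?_
    rintro rfl
    exact h2 hj
  · ext i
    simp only [Finset.mem_biUnion, Finset.mem_union, Finset.mem_image, Finset.mem_filter]
    constructor
    · rintro ⟨j, hj, hi | ⟨k, ⟨hk, hw⟩, rfl⟩⟩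
      · exact Or.inl ⟨j, hj, hi⟩
      · exact Or.inr ⟨k, ⟨hk, j, hj, hw⟩, rfl⟩
    · rintro (⟨j, hj, hi⟩ | ⟨k, ⟨hk, j, hj, hw⟩, rfl⟩)
      · exact ⟨j, hj, Or.inl hi⟩
      · exact ⟨j, hj, Or.inr ⟨k, ⟨hk, hw⟩, rfl⟩⟩
  · rw [Finset.image_empty, Finset.union_empty]

open Classical in
theorem measurable_prod_samples (hc : 0 < m.ζ / (m.ps * m.K)) (J : Finset (Fin M))
    {φ : ℝ → ℝ≥0∞} (hφ : Measurable φ) (l : ℕ) :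
    Measurable fun ω => ∏ i ∈ J.biUnion (memory m share L z ω l).obs, φ ((ω i.1).X i.2) :=
  measurable_apply_countable (F := fun (ω : ℕ → Stage M) (S : Memory M) =>
      ∏ i ∈ J.biUnion S.obs, φ ((ω i.1).X i.2))
    (fun _ => Finset.measurable_fun_prod _ fun i _ => hφ.comp (measurable_sample i))
    (measurable_memory hc l)

theorem lintegral_prod_newEpochs_le_one (hps : 0 < m.ps) (J : Finset (Fin M)) (l : ℕ)
    (S : Memory M) {θ : Fin M → ℝ} (hθ : ∀ i, 0 < m.law (Set.Ici (θ i)))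
    {φ : ℝ → ℝ≥0∞} (hφ : Measurable φ) (h1 : ∫⁻ x, φ x ∂m.law ≤ 1) :
    ∫⁻ s, ∏ k ∈ newEpochs L z J l S θ s, φ (s.X k) ∂m.stageLaw ≤ 1 := by
  classical
  by_cases hE : (explore L z l S).Nonempty
  · refine le_trans (le_of_eq (lintegral_congr fun s => ?_))
      (Stage.lintegral_explore_le_one (m := m) _ hE J hφ h1)
    simp only [newEpochs, dif_pos hE]
    split_ifs <;> simp
  · refine le_trans (le_of_eq (lintegral_congr fun s => ?_))
      (Stage.lintegral_prod_exploit_le_one hps hθ J hφ h1)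
    simp only [newEpochs, dif_neg hE]
    split_ifs with h
    · congr!
    · simp

open Classical in
/-- Although the samples of the users in `J` are collected adaptively, a product over them of a
factor of mean at most one still has mean at most one: which samples are collected is decided
before their values are seen. -/
theorem lintegral_prod_samples_le_one (hps : 0 < m.ps) (hc : 0 < m.ζ / (m.ps * m.K))
    (hmean : 0 < ∫ x, x ∂m.law) (hshare : ∀ j, j ∈ share j) (J : Finset (Fin M))
    {φ : ℝ → ℝ≥0∞} (hφ : Measurable φ) (hφt : ∀ x, φ x ≠ ∞) (h1 : ∫⁻ x, φ x ∂m.law ≤ 1)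
    (l : ℕ) :
    ∫⁻ ω, ∏ i ∈ J.biUnion (memory m share L z ω l).obs, φ ((ω i.1).X i.2) ∂m.P ≤ 1 := by
  induction l with
  | zero =>
    have hset : J.biUnion (init (M := M)).obs
        = (J.image (fun j : Fin M => (j : ℕ))).image fun k => (0, k) := by
      ext i
      simp [init, eq_comm]
    have hG : Measurable fun s : Stage M =>
        ∏ k ∈ J.image (fun j : Fin M => (j : ℕ)), φ (s.X k) :=
      Finset.measurable_fun_prod _ fun k _ => hφ.comp (Stage.measurable_X k)
    have hG' : Measurable fun x : ℕ → ℝ =>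
        ∏ k ∈ J.image (fun j : Fin M => (j : ℕ)), φ (x k) :=
      Finset.measurable_fun_prod _ fun k _ => hφ.comp (measurable_pi_apply k)
    simp only [memory]
    rw [hset]
    simp only [Finset.prod_image (g := fun k : ℕ => ((0 : ℕ), k))
      (fun a _ b _ h => (Prod.mk.inj h).2)]
    rw [(measurePreserving_stage m 0).lintegral_comp hG]
    rw [show ∫⁻ s : Stage M, ∏ k ∈ J.image (fun j : Fin M => (j : ℕ)), φ (s.X k) ∂m.stageLaw = _
      from (Stage.measurePreserving_qualities m).lintegral_comp hG']
    rw [lintegral_prod_infinitePi _ fun _ => hφ]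
    exact Finset.prod_le_one' fun _ _ => h1
  | succ l ih =>
    rw [lintegral_P_eq m (l + 1) (measurable_prod_samples hc J hφ (l + 1))]
    refine le_trans (lintegral_mono_ae ?_) ih
    filter_upwards [ae_forall_sample (ae_measure_Ici_pos m.law)] with ω hω
    set S := memory m share L z ω l with hS
    set θ := estThreshold m share S ω with hθ
    have hθpos : ∀ j, 0 < m.law (Set.Ici (θ j)) := fun j =>
      measure_Ici_threshold_empirical_pos hc hmean (samples_nonempty hshare ω l j) hω
    have hsplit : ∀ s, ∏ i ∈ J.biUnion (memory m share L z (Function.update ω (l + 1) s)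
          (l + 1)).obs, φ ((Function.update ω (l + 1) s i.1).X i.2)
        = (∏ i ∈ J.biUnion S.obs, φ ((ω i.1).X i.2))
          * ∏ k ∈ newEpochs L z J (l + 1) S θ s, φ (s.X k) := by
      intro s
      have hle : ∀ i ∈ J.biUnion S.obs, i.1 ≤ l := by
        intro i hi
        obtain ⟨j, -, hj⟩ := Finset.mem_biUnion.1 hi
        exact obs_fst_le ω l j i hj
      rw [biUnion_obs_succ, memory_update ω (Nat.lt_succ_self l),
        estThreshold_update ω (Nat.lt_succ_self l), Function.update_self, Finset.prod_union]
      · congr 1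
        · refine Finset.prod_congr rfl fun i hi => ?_
          have := hle i hi
          rw [Function.update_of_ne (by omega)]
        · rw [Finset.prod_image fun a _ b _ h => (Prod.mk.inj h).2]
          simp only [Function.update_self]
          rfl
      · refine Finset.disjoint_left.2 fun i hi hi' => ?_
        obtain ⟨k, -, rfl⟩ := Finset.mem_image.1 hi'
        have := hle _ hi
        simp only at this
        omega
    simp only [hsplit]
    rw [lintegral_const_mul' _ _ (ENNReal.prod_ne_top fun i _ => hφt _)]
    calc _ ≤ (∏ i ∈ J.biUnion S.obs, φ ((ω i.1).X i.2)) * 1 := by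
          gcongr
          exact lintegral_prod_newEpochs_le_one hps J (l + 1) S hθpos hφ h1
      _ = _ := mul_one _

/-- Hoeffding's inequality for the adaptively collected samples of user `j`, whose number is
random: the exponential supermartingale absorbs the normalization by the number of samples. -/
theorem measure_samples_deviation_le (hps : 0 < m.ps) (hc : 0 < m.ζ / (m.ps * m.K))
    (hmean : 0 < ∫ x, x ∂m.law) (hshare : ∀ j, j ∈ share j) (l : ℕ) (j : Fin M)
    {g : ℝ → ℝ} (hg : Measurable g) {a b : ℝ} (hab : a < b)
    (hgab : ∀ᵐ x ∂m.law, g x ∈ Set.Icc a b) {δ : ℝ} (hδ : 0 < δ) (D : ℝ) :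
    m.P {ω | D ≤ (samples share (memory m share L z ω l) j).card ∧
        (samples share (memory m share L z ω l) j).card * δ
          ≤ ∑ i ∈ samples share (memory m share L z ω l) j,
              (g ((ω i.1).X i.2) - ∫ x, g x ∂m.law)}
      ≤ ENNReal.ofReal (Real.exp (-(2 * δ ^ 2 / (b - a) ^ 2) * D)) := by
  classical
  set e := ∫ x, g x ∂m.law with he
  set σ : ℝ := ((b - a) / 2) ^ 2 with hσ
  have hba : 0 < b - a := sub_pos.2 hab
  have hσpos : 0 < σ := by positivity
  set lam := δ / σ with hlam
  have hsub := hasSubgaussianMGF_of_mem_Icc hg.aemeasurable hgab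
  set φ : ℝ → ℝ≥0∞ := fun x => ENNReal.ofReal (Real.exp (lam * (g x - e) - lam ^ 2 * σ / 2))
    with hφ
  have hφm : Measurable φ := by fun_prop
  have hφ1 : ∫⁻ x, φ x ∂m.law ≤ 1 := by
    have hint : Integrable (fun x => Real.exp (lam * (g x - e) - lam ^ 2 * σ / 2)) m.law := by
      simp only [sub_eq_add_neg _ (lam ^ 2 * σ / 2), Real.exp_add]
      exact (hsub.integrable_exp_mul lam).mul_const _
    rw [hφ, ← ofReal_integral_eq_lintegral_ofReal hint (ae_of_all _ fun x => (Real.exp_pos _).le)]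
    rw [ENNReal.ofReal_le_one]
    simp only [sub_eq_add_neg _ (lam ^ 2 * σ / 2), Real.exp_add]
    rw [integral_mul_const]
    have hmgf := hsub.mgf_le lam
    have hcoe : (((‖b - a‖₊ / 2) ^ 2 : NNReal) : ℝ) = σ := by
      simp [hσ, abs_of_pos hba]
    rw [hcoe] at hmgf
    simp only [mgf] at hmgf
    calc _ ≤ Real.exp (σ * lam ^ 2 / 2) * Real.exp (-(lam ^ 2 * σ / 2)) := by gcongr
      _ = 1 := by
        rw [← Real.exp_add]
        ring_nf
        exact Real.exp_zero
  set Z : (ℕ → Stage M) → ℝ≥0∞ := fun ω =>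
    ∏ i ∈ (share j).biUnion (memory m share L z ω l).obs, φ ((ω i.1).X i.2) with hZ
  have hZm : Measurable Z := measurable_prod_samples hc (share j) hφm l
  have hZ1 : ∫⁻ ω, Z ω ∂m.P ≤ 1 := lintegral_prod_samples_le_one hps hc hmean hshare (share j) hφm
    (fun x => ENNReal.ofReal_ne_top) hφ1 l
  set t : ℝ := 2 * δ ^ 2 / (b - a) ^ 2 * D with ht
  have hσt : δ ^ 2 / (2 * σ) = 2 * δ ^ 2 / (b - a) ^ 2 := by
    rw [hσ]
    field_simp
  have hexp0 : ENNReal.ofReal (Real.exp t) ≠ 0 := by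
    simpa using Real.exp_pos t
  have hmarkov : m.P {ω | ENNReal.ofReal (Real.exp t) ≤ Z ω}
      ≤ ENNReal.ofReal (Real.exp (-(2 * δ ^ 2 / (b - a) ^ 2) * D)) := by
    refine (meas_ge_le_lintegral_div hZm.aemeasurable hexp0 ENNReal.ofReal_ne_top).trans ?_
    rw [neg_mul, Real.exp_neg, ENNReal.ofReal_inv_of_pos (Real.exp_pos _), ← one_div]
    gcongr
  refine (measure_mono fun ω hω => ?_).trans hmarkov
  obtain ⟨hD, hdev⟩ := hω
  set I := samples share (memory m share L z ω l) j with hI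
  have hZI : Z ω = ENNReal.ofReal (Real.exp
      (lam * ∑ i ∈ I, (g ((ω i.1).X i.2) - e) - I.card * (lam ^ 2 * σ / 2))) := by
    change ∏ i ∈ I, ENNReal.ofReal (Real.exp (lam * (g ((ω i.1).X i.2) - e) - lam ^ 2 * σ / 2))
      = _
    rw [← ENNReal.ofReal_prod_of_nonneg fun i _ => (Real.exp_pos _).le, ← Real.exp_sum,
      Finset.sum_sub_distrib, Finset.mul_sum, Finset.sum_const, nsmul_eq_mul]
  change ENNReal.ofReal (Real.exp t) ≤ Z ω
  rw [hZI]
  refine ENNReal.ofReal_le_ofReal (Real.exp_le_exp.2 ?_)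
  have hlampos : 0 < lam := div_pos hδ hσpos
  calc t = δ ^ 2 / (2 * σ) * D := by rw [ht, hσt]
    _ ≤ δ ^ 2 / (2 * σ) * I.card := by gcongr
    _ = lam * (I.card * δ) - I.card * (lam ^ 2 * σ / 2) := by
        rw [hlam]
        field_simp
        ring
    _ ≤ _ := by gcongr

/-- In an exploitation stage every estimated threshold is within `ε` of `x*`, up to an event of
exponentially small probability. -/
theorem measure_estThreshold_deviation_le (hps : 0 < m.ps) (hc : 0 < m.ζ / (m.ps * m.K))
    (hmean : 0 < ∫ x, x ∂m.law) (hshare : ∀ j, j ∈ share j) {B : ℝ} (hB0 : 0 ≤ B)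
    (hB : ∀ᵐ x ∂m.law, |x| ≤ B) {ε : ℝ} (hε : 0 < ε) (hε1 : ε ≤ 1) (l n : ℕ) (j : Fin M) :
    m.P {ω | ¬ (explore L z l (memory m share L z ω n)).Nonempty ∧
        ε < |estThreshold m share (memory m share L z ω n) ω j
          - threshold (m.ζ / (m.ps * m.K)) m.law|}
      ≤ 2 * ENNReal.ofReal (Real.exp
          (-(2 * (m.ζ / (m.ps * m.K) * ε) ^ 2 / (B + 1) ^ 2) * D₁ L z l)) := by
  set c := m.ζ / (m.ps * m.K) with hcdef
  set x₀ := threshold c m.law with hx₀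
  have hint : Integrable (fun x : ℝ => x) m.law :=
    Integrable.of_bound (by fun_prop) B hB
  have hx0 : 0 ≤ x₀ := threshold_nonneg hc hint
  have hthr : ∫ x, max (x - x₀) 0 ∂m.law = c * x₀ := isThreshold_threshold hc hint
  have hδ : 0 < c * ε := by positivity
  have hrange : ∀ u : ℝ, -1 ≤ u → ∀ᵐ x ∂m.law, max (x - u) 0 ∈ Set.Icc 0 (B + 1) := by
    intro u hu
    filter_upwards [hB] with x hx
    refine ⟨le_max_right _ _, max_le ?_ (by linarith)⟩
    linarith [(abs_le.1 hx).2]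
  have hup := measure_samples_deviation_le (L := L) (z := z) hps hc hmean hshare n j
    (g := fun x => max (x - (x₀ + ε)) 0) (by fun_prop) (a := 0) (b := B + 1) (by linarith)
    (hrange _ (by linarith)) hδ (D₁ L z l)
  have hlo := measure_samples_deviation_le (L := L) (z := z) hps hc hmean hshare n j
    (g := fun x => -max (x - (x₀ - ε)) 0) (by fun_prop) (a := -(B + 1)) (b := 0) (by linarith)
    (by
      filter_upwards [hrange (x₀ - ε) (by linarith)] with x hx
      exact ⟨neg_le_neg hx.2, neg_nonpos.2 hx.1⟩) hδ (D₁ L z l)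
  rw [show B + 1 - 0 = B + 1 by ring] at hup
  rw [show 0 - -(B + 1) = B + 1 by ring] at hlo
  rw [two_mul]
  refine le_trans ((measure_mono fun ω hω => ?_).trans (measure_union_le _ _)) (add_le_add hup hlo)
  obtain ⟨hexp, hdev⟩ := hω
  set S := memory m share L z ω n with hS
  set I := samples share S j with hI
  have hIne : I.Nonempty := samples_nonempty hshare ω n j
  have hcard : (0 : ℝ) < I.card := by exact_mod_cast hIne.card_pos
  have hest : estThreshold m share S ω j = threshold c (empirical I ω) := rfl
  have hD : D₁ L z l ≤ I.card := by
    have h1 : D₁ L z l ≤ S.count j := by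
      by_contra! hlt
      exact hexp ⟨j, Finset.mem_filter.2 ⟨Finset.mem_univ j, hlt⟩⟩
    exact h1.trans (by exact_mod_cast count_le_card_samples hshare ω n j)
  have hiff := fun u => le_threshold_empirical_iff hc hIne ω u
  rw [hest] at hdev
  rcases lt_abs.1 hdev with h | h
  · left
    refine ⟨hD, ?_⟩
    have h1 := (hiff (x₀ + ε)).1 (by linarith)
    rw [inv_mul_eq_div, le_div_iff₀ hcard] at h1
    have h2 := integral_max_sub_mono hint (show x₀ ≤ x₀ + ε by linarith)
    rw [Finset.sum_sub_distrib, Finset.sum_const, nsmul_eq_mul]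
    change (I.card : ℝ) * (c * ε) ≤ _
    nlinarith
  · right
    refine ⟨hD, ?_⟩
    have h1 : ¬ x₀ - ε ≤ threshold c (empirical I ω) := by
      intro h'
      linarith
    rw [hiff, not_le, inv_mul_eq_div, div_lt_iff₀ hcard] at h1
    have h2 := integral_max_sub_mono hint (show x₀ - ε ≤ x₀ by linarith)
    rw [Finset.sum_sub_distrib, Finset.sum_const, nsmul_eq_mul, integral_neg,
      Finset.sum_neg_distrib]
    change (I.card : ℝ) * (c * ε) ≤ _
    nlinarith

end OnlineMU

/-! ### The law of the qualities -/

section Law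

theorem ae_essInf_le_and_le_essSup {μ : Measure ℝ} {B : ℝ} (hB : ∀ᵐ x ∂μ, |x| ≤ B) :
    ∀ᵐ x ∂μ, essInf (fun x : ℝ => x) μ ≤ x ∧ x ≤ essSup (fun x : ℝ => x) μ := by
  have h1 : IsBoundedUnder (· ≤ ·) (ae μ) fun x : ℝ => x :=
    isBoundedUnder_of_eventually_le (hB.mono fun x hx => (abs_le.1 hx).2)
  have h2 : IsBoundedUnder (· ≥ ·) (ae μ) fun x : ℝ => x :=
    isBoundedUnder_of_eventually_ge (hB.mono fun x hx => (abs_le.1 hx).1)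
  filter_upwards [ae_essInf_le h2, ae_le_essSup h1] with x hx1 hx2 using ⟨hx1, hx2⟩

theorem measure_Ioc_le_of_cdf {μ : Measure ℝ} [IsProbabilityMeasure μ] {lip α : ℝ}
    (hLip : ∀ x δ : ℝ, |cdf μ (x + δ) - cdf μ x| ≤ lip * |δ| ^ α) {a b : ℝ} (hab : a ≤ b) :
    μ (Set.Ioc a b) ≤ ENNReal.ofReal (lip * (b - a) ^ α) := by
  have h := hLip a (b - a)
  rw [add_sub_cancel, abs_of_nonneg (sub_nonneg.2 hab)] at h
  have h2 : μ (Set.Ioc a b) = ENNReal.ofReal (cdf μ b - cdf μ a) := by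
    conv_lhs => rw [← measure_cdf μ]
    rw [StieltjesFunction.measure_Ioc]
  rw [h2]
  exact ENNReal.ofReal_le_ofReal ((le_abs_self _).trans h)

/-- A law with a Hölder continuous distribution function has no atoms, hence is not constant. -/
theorem essInf_lt_essSup_of_cdf {μ : Measure ℝ} [IsProbabilityMeasure μ] {B lip α : ℝ}
    (hB : ∀ᵐ x ∂μ, |x| ≤ B) (hα : 0 < α)
    (hLip : ∀ x δ : ℝ, |cdf μ (x + δ) - cdf μ x| ≤ lip * |δ| ^ α) :
    essInf (fun x : ℝ => x) μ < essSup (fun x : ℝ => x) μ := by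
  by_contra! hle
  set a := essInf (fun x : ℝ => x) μ
  have hconst : ∀ᵐ x ∂μ, x = a := by
    filter_upwards [ae_essInf_le_and_le_essSup hB] with x hx
    exact le_antisymm (hx.2.trans hle) hx.1
  have h1 : ∀ n : ℕ, (1 : ENNReal) ≤ ENNReal.ofReal (lip * (1 / ((n : ℝ) + 1)) ^ α) := by
    intro n
    have hpos : (0 : ℝ) < 1 / ((n : ℝ) + 1) := by positivity
    have h2 := measure_Ioc_le_of_cdf hLip (show a - 1 / ((n : ℝ) + 1) ≤ a by linarith)
    rw [sub_sub_cancel] at h2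
    refine le_trans (le_of_eq ?_) h2
    symm
    rw [prob_compl_eq_zero_iff measurableSet_Ioc |>.symm, ← mem_ae_iff]
    filter_upwards [hconst] with x hx
    rw [hx]
    exact ⟨by linarith, le_rfl⟩
  have h2 : Tendsto (fun n : ℕ => ENNReal.ofReal (lip * (1 / ((n : ℝ) + 1)) ^ α)) atTop
      (𝓝 0) := by
    have h3 : Tendsto (fun n : ℕ => lip * (1 / ((n : ℝ) + 1)) ^ α) atTop (𝓝 (lip * 0 ^ α)) :=
      (tendsto_one_div_add_atTop_nhds_zero_nat.rpow_const (Or.inr hα.le)).const_mul lip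
    rw [Real.zero_rpow hα.ne', mul_zero] at h3
    simpa using ENNReal.tendsto_ofReal h3
  exact absurd (ge_of_tendsto' h2 h1) (by simp)

end Law

namespace OnlineMU

open scoped ENNReal

variable {M : ℕ} {m : ModelI M} {share : Fin M → Finset (Fin M)} {L z : ℝ}

/-! ### Disagreement with the reference policy -/

/-- Stage `l` is an exploitation stage in which the algorithm and the reference policy earn
different rewards. -/
def Disagree (m : ModelI M) (share : Fin M → Finset (Fin M)) (L z : ℝ) (l : ℕ) :
    Set (ℕ → Stage M) :=
  {ω | ¬ (explore L z l (memory m share L z ω (l - 1))).Nonempty ∧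
    offlineReward m (ω l) ≠ reward m share L z l ω}

theorem measurable_offlineReward (m : ModelI M) (l : ℕ) :
    Measurable fun ω : ℕ → Stage M => offlineReward m (ω l) :=
  (Stage.measurable_thresholdReward_const m _).comp (measurable_pi_apply l)

theorem measurableSet_disagree (hc : 0 < m.ζ / (m.ps * m.K)) (l : ℕ) :
    MeasurableSet (Disagree m share L z l) := by
  refine (measurableSet_explore hc l (l - 1)).compl.inter ?_
  exact (measurableSet_eq_fun (measurable_offlineReward m l) (measurable_reward hc l)).compl

/-- If all estimates are accurate, disagreement requires that the first quality above the lower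
end of the uncertainty interval falls into that interval. -/
theorem measure_disagree_of_near_le (hps : 0 < m.ps) (hc : 0 < m.ζ / (m.ps * m.K)) {l : ℕ}
    (hl : 1 ≤ l) {ε : ℝ} (hε : 0 ≤ ε) :
    m.P (Disagree m share L z l ∩ {ω | ∀ j,
        |estThreshold m share (memory m share L z ω (l - 1)) ω j
          - threshold (m.ζ / (m.ps * m.K)) m.law| ≤ ε})
      ≤ (m.law (Set.Ici (threshold (m.ζ / (m.ps * m.K)) m.law - ε)))⁻¹
        * m.law (Set.Ico (threshold (m.ζ / (m.ps * m.K)) m.law - ε)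
            (threshold (m.ζ / (m.ps * m.K)) m.law + ε)) := by
  set x₀ := threshold (m.ζ / (m.ps * m.K)) m.law with hx₀
  set r := (m.law (Set.Ici (x₀ - ε)))⁻¹ * m.law (Set.Ico (x₀ - ε) (x₀ + ε))
  set A := Disagree m share L z l ∩ {ω | ∀ j,
    |estThreshold m share (memory m share L z ω (l - 1)) ω j - x₀| ≤ ε} with hA
  have hAm : MeasurableSet A := by
    refine (measurableSet_disagree hc l).inter ?_
    rw [Set.ofPred_forall]
    refine MeasurableSet.iInter fun j => measurableSet_le ?_ measurable_const
    have h1 : Measurable fun ω =>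
        estThreshold m share (memory m share L z ω (l - 1)) ω j :=
      (measurable_pi_apply j).comp (measurable_estThreshold_memory hc (l - 1))
    exact (h1.sub_const x₀).abs
  rw [← lintegral_indicator_one hAm, lintegral_P_eq m l (measurable_one.indicator hAm)]
  refine (lintegral_mono (g := fun _ => r) fun ω => ?_).trans (by simp)
  have hlt : l - 1 < l := by omega
  by_cases hgood : ∀ j, |estThreshold m share (memory m share L z ω (l - 1)) ω j - x₀| ≤ ε
  · set θ := estThreshold m share (memory m share L z ω (l - 1)) ω with hθ
    have hle : ∀ s, A.indicator (1 : (ℕ → Stage M) → ℝ≥0∞) (Function.update ω l s)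
        ≤ {s | s.thresholdReward m (fun _ => x₀) ≠ s.thresholdReward m θ}.indicator 1 s := by
      intro s
      by_cases hs : Function.update ω l s ∈ A
      · rw [Set.indicator_of_mem hs, Set.indicator_of_mem]
        · simp
        · obtain ⟨⟨h1, h2⟩, -⟩ := hs
          simp only [memory_update ω hlt] at h1
          simp only [reward, memory_update ω hlt, estThreshold_update ω hlt,
            Function.update_self, if_neg h1] at h2
          exact h2
      · rw [Set.indicator_of_notMem hs]
        exact zero_le
    refine (lintegral_mono hle).trans ?_
    have hms : MeasurableSet
        {s : Stage M | s.thresholdReward m (fun _ => x₀) ≠ s.thresholdReward m θ} :=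
      (measurableSet_eq_fun (Stage.measurable_thresholdReward_const m _)
        (Stage.measurable_thresholdReward_const m _)).compl
    rw [lintegral_indicator_one hms]
    exact Stage.measure_thresholdReward_ne_le hps (fun _ => by simpa using hε) hgood
  · have h0 : ∀ s, A.indicator (1 : (ℕ → Stage M) → ℝ≥0∞) (Function.update ω l s) = 0 := by
      intro s
      refine Set.indicator_of_notMem (fun hs => hgood ?_) _
      have h2 := hs.2
      simp only [Set.mem_ofPred_eq, memory_update ω hlt, estThreshold_update ω hlt] at h2
      exact h2
    simp [h0]

/-- The exploration rate is matched to the accuracy `l ^ (-z / 2)`: with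
`L ≥ (B + 1)² / c²` the exponential bound becomes `l⁻²`. -/
theorem exp_deviation_le {c B : ℝ} (hc : 0 < c) (hB0 : 0 ≤ B) (hL : (B + 1) ^ 2 / c ^ 2 ≤ L)
    {l : ℕ} (hl : 1 ≤ l) :
    Real.exp (-(2 * (c * (l : ℝ) ^ (-(z / 2))) ^ 2 / (B + 1) ^ 2) * D₁ L z l)
      ≤ 1 / (l : ℝ) ^ (2 : ℝ) := by
  have h1 : (1 : ℝ) ≤ l := by exact_mod_cast hl
  have h0 : (0 : ℝ) < l := by linarith
  have hlog : 0 ≤ Real.log l := Real.log_nonneg h1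
  have hzz : ((l : ℝ) ^ (-(z / 2))) ^ 2 * (l : ℝ) ^ z = 1 := by
    rw [← Real.rpow_natCast, ← Real.rpow_mul h0.le, ← Real.rpow_add h0]
    norm_num
  have hle : 2 * Real.log l
      ≤ 2 * (c * (l : ℝ) ^ (-(z / 2))) ^ 2 / (B + 1) ^ 2 * D₁ L z l := by
    have hcalc : 2 * (c * (l : ℝ) ^ (-(z / 2))) ^ 2 / (B + 1) ^ 2 * D₁ L z l
        = 2 * Real.log l * (c ^ 2 / (B + 1) ^ 2 * L)
          * (((l : ℝ) ^ (-(z / 2))) ^ 2 * (l : ℝ) ^ z) := by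
      unfold D₁
      ring
    rw [hcalc, hzz, mul_one]
    refine le_mul_of_one_le_right (by positivity) ?_
    rw [div_le_iff₀ (by positivity)] at hL
    rw [div_mul_eq_mul_div, le_div_iff₀ (by positivity)]
    linarith
  calc _ ≤ Real.exp (-(2 * Real.log l)) := by
        rw [neg_mul]
        gcongr
    _ = 1 / (l : ℝ) ^ (2 : ℝ) := by
        rw [Real.exp_neg, one_div, Real.rpow_def_of_pos h0, mul_comm]

theorem measureReal_disagree_le (hζ : 0 < m.ζ) (hK : 0 < m.K) (hps : 0 < m.ps) {B : ℝ}
    (hB0 : 0 ≤ B) (hB : ∀ᵐ x ∂m.law, |x| ≤ B) (hmean : 0 < ∫ x, x ∂m.law) {lip α : ℝ}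
    (hLip : ∀ x δ : ℝ, |cdf m.law (x + δ) - cdf m.law x| ≤ lip * |δ| ^ α) (hz : 0 ≤ z)
    (hshare : ∀ j, j ∈ share j)
    (hL : (B + 1) ^ 2 / (m.ζ / (m.ps * m.K)) ^ 2 ≤ L) {l : ℕ} (hl : 1 ≤ l) :
    m.P.real (Disagree m share L z l)
      ≤ lip * 3 ^ α / m.law.real (Set.Ici (threshold (m.ζ / (m.ps * m.K)) m.law))
          * (1 / (l : ℝ) ^ (α * z / 2)) + 2 * M * (1 / (l : ℝ) ^ (2 : ℝ)) := by
  have hc : 0 < m.ζ / (m.ps * m.K) := by positivity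
  set c := m.ζ / (m.ps * m.K) with hcdef
  set x₀ := threshold c m.law with hx₀
  have hint : Integrable (fun x : ℝ => x) m.law := Integrable.of_bound (by fun_prop) B hB
  have hq : 0 < m.law (Set.Ici x₀) := measure_Ici_threshold_pos hc hint hmean
  have h1 : (1 : ℝ) ≤ l := by exact_mod_cast hl
  have h0 : (0 : ℝ) < l := by linarith
  set ε : ℝ := (l : ℝ) ^ (-(z / 2)) with hε
  have hεpos : 0 < ε := Real.rpow_pos_of_pos h0 _
  have hε1 : ε ≤ 1 := Real.rpow_le_one_of_one_le_of_nonpos h1 (by linarith)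
  have hlip0 : 0 ≤ lip := by
    have := (abs_nonneg _).trans (hLip 0 1)
    simpa using this
  have hnear : m.P (Disagree m share L z l ∩ {ω | ∀ j,
      |estThreshold m share (memory m share L z ω (l - 1)) ω j - x₀| ≤ ε})
      ≤ ENNReal.ofReal (lip * 3 ^ α / m.law.real (Set.Ici x₀) * (1 / (l : ℝ) ^ (α * z / 2))) := by
    refine (measure_disagree_of_near_le hps hc hl hεpos.le).trans ?_
    have hεα : (x₀ + ε - (x₀ - 2 * ε)) ^ α = 3 ^ α * (1 / (l : ℝ) ^ (α * z / 2)) := by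
      rw [show x₀ + ε - (x₀ - 2 * ε) = 3 * ε by ring, Real.mul_rpow (by norm_num) hεpos.le, hε,
        ← Real.rpow_mul h0.le, one_div, ← Real.rpow_neg h0.le]
      ring_nf
    have hIco : m.law (Set.Ico (x₀ - ε) (x₀ + ε))
        ≤ ENNReal.ofReal (lip * (3 ^ α * (1 / (l : ℝ) ^ (α * z / 2)))) := by
      rw [← hεα]
      refine (measure_mono fun x hx => ?_).trans
        (measure_Ioc_le_of_cdf hLip (show x₀ - 2 * ε ≤ x₀ + ε by linarith))
      exact ⟨by linarith [hx.1], hx.2.le⟩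
    calc _ ≤ (m.law (Set.Ici x₀))⁻¹
          * ENNReal.ofReal (lip * (3 ^ α * (1 / (l : ℝ) ^ (α * z / 2)))) := by
          gcongr
          linarith
      _ = _ := by
          have hreal : 0 < m.law.real (Set.Ici x₀) :=
            ENNReal.toReal_pos hq.ne' (measure_ne_top _ _)
          rw [← ofReal_measureReal (μ := m.law), ← ENNReal.ofReal_inv_of_pos hreal,
            ← ENNReal.ofReal_mul (by positivity)]
          congr 1
          ring
  have hsub : Disagree m share L z l ⊆
      (Disagree m share L z l ∩ {ω | ∀ j,
        |estThreshold m share (memory m share L z ω (l - 1)) ω j - x₀| ≤ ε})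
      ∪ ⋃ j, {ω | ¬ (explore L z l (memory m share L z ω (l - 1))).Nonempty ∧
        ε < |estThreshold m share (memory m share L z ω (l - 1)) ω j - x₀|} := by
    intro ω hω
    by_cases hgood : ∀ j, |estThreshold m share (memory m share L z ω (l - 1)) ω j - x₀| ≤ ε
    · exact Or.inl ⟨hω, hgood⟩
    · push Not at hgood
      obtain ⟨j, hj⟩ := hgood
      exact Or.inr (Set.mem_iUnion.2 ⟨j, hω.1, hj⟩)
  have hfar : m.P (⋃ j, {ω | ¬ (explore L z l (memory m share L z ω (l - 1))).Nonempty ∧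
      ε < |estThreshold m share (memory m share L z ω (l - 1)) ω j - x₀|})
      ≤ ENNReal.ofReal (2 * M * (1 / (l : ℝ) ^ (2 : ℝ))) := by
    refine (measure_iUnion_le _).trans ?_
    calc _ ≤ ∑' _j : Fin M, 2 * ENNReal.ofReal (1 / (l : ℝ) ^ (2 : ℝ)) := by
          refine ENNReal.tsum_le_tsum fun j => ?_
          refine (measure_estThreshold_deviation_le hps hc hmean hshare hB0 hB hεpos hε1 l (l - 1)
            j).trans ?_
          gcongr
          exact exp_deviation_le hc hB0 hL hl
      _ = _ := by
          rw [tsum_fintype, Finset.sum_const, Finset.card_univ, Fintype.card_fin, nsmul_eq_mul,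
            ENNReal.ofReal_mul (by positivity), ENNReal.ofReal_mul (by norm_num)]
          simp
          ring
  refine ENNReal.toReal_le_of_le_ofReal (by positivity) ?_
  rw [ENNReal.ofReal_add (by positivity) (by positivity)]
  exact (measure_mono hsub).trans ((measure_union_le _ _).trans (add_le_add hnear hfar))

/-! ### The regret -/

open Classical in
/-- The cost `κ` of an exploration stage plus the cost `b` of a disagreement, summed over the
stages, in expectation. -/
theorem integral_sum_le (hζ : 0 < m.ζ) (hK : 0 < m.K) (hps : 0 < m.ps) (hL : 0 ≤ L)
    (hz : 0 ≤ z) {κ b : ℝ} (hκ : 0 ≤ κ) (hb : 0 ≤ b) {f : ℕ → (ℕ → Stage M) → ℝ}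
    {d : ℕ → ℝ} {H : ℕ}
    (hd : ∀ l ∈ Finset.Icc 1 H, m.P.real (Disagree m share L z l) ≤ d l)
    (hf : Integrable (fun ω => ∑ l ∈ Finset.Icc 1 H, f l ω) m.P)
    (hle : ∀ᵐ ω ∂m.P, ∀ l ∈ Finset.Icc 1 H, f l ω
      ≤ κ * (if (explore L z l (memory m share L z ω (l - 1))).Nonempty then 1 else 0)
        + (Disagree m share L z l).indicator (fun _ => b) ω) :
    ∫ ω, ∑ l ∈ Finset.Icc 1 H, f l ω ∂m.P
      ≤ κ * (M * D₁ L z H) + b * ∑ l ∈ Finset.Icc 1 H, d l := by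
  have hc : 0 < m.ζ / (m.ps * m.K) := by positivity
  have hI : ∀ l, Integrable ((Disagree m share L z l).indicator fun _ => b) m.P := fun l =>
    (integrable_const b).indicator (measurableSet_disagree hc l)
  have hI' : Integrable (fun ω => ∑ l ∈ Finset.Icc 1 H,
      (Disagree m share L z l).indicator (fun _ => b) ω) m.P :=
    integrable_finsetSum _ fun l _ => hI l
  calc ∫ ω, ∑ l ∈ Finset.Icc 1 H, f l ω ∂m.P
      ≤ ∫ ω, (κ * (M * D₁ L z H)
          + ∑ l ∈ Finset.Icc 1 H, (Disagree m share L z l).indicator (fun _ => b) ω) ∂m.P := by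
        refine integral_mono_ae hf ((integrable_const _).add hI') ?_
        filter_upwards [hle] with ω hω
        refine (Finset.sum_le_sum hω).trans ?_
        rw [Finset.sum_add_distrib, ← Finset.mul_sum]
        gcongr
        exact sum_explore_le hL hz ω H
    _ = κ * (M * D₁ L z H) + ∑ l ∈ Finset.Icc 1 H, b * m.P.real (Disagree m share L z l) := by
        rw [integral_add (integrable_const _) hI', integral_finsetSum _ fun l _ => hI l]
        simp only [integral_const, probReal_univ,
          integral_indicator_const b (measurableSet_disagree hc _), smul_eq_mul, one_mul,
          mul_comm b]
    _ ≤ _ := by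
        rw [Finset.mul_sum]
        gcongr with l hl
        exact hd l hl

theorem ae_abs_rewards_le (hζ : 0 < m.ζ) (hK : 0 < m.K) {B : ℝ}
    (hB : ∀ᵐ x ∂m.law, |x| ≤ B) :
    ∀ᵐ ω ∂m.P, ∀ l, |offlineReward m (ω l)| ≤ B ∧ |reward m share L z l ω| ≤ B := by
  filter_upwards [ae_forall_sample hB] with ω hω l
  refine ⟨Stage.abs_thresholdReward_le hζ hK (hω l) _, ?_⟩
  unfold reward
  simp only
  split_ifs
  · exact Stage.abs_rate_le hζ hK (hω l 0)
  · exact Stage.abs_thresholdReward_le hζ hK (hω l) _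

theorem integrable_offlineReward (hζ : 0 < m.ζ) (hK : 0 < m.K) {B : ℝ}
    (hB : ∀ᵐ x ∂m.law, |x| ≤ B) (l : ℕ) :
    Integrable (fun ω : ℕ → Stage M => offlineReward m (ω l)) m.P := by
  refine Integrable.of_bound
    (measurable_offlineReward m l).aestronglyMeasurable B ?_
  filter_upwards [ae_abs_rewards_le (share := fun _ => ∅) (L := 0) (z := 0) hζ hK hB] with ω hω
  exact (hω l).1

theorem integrable_reward (hζ : 0 < m.ζ) (hK : 0 < m.K) (hps : 0 < m.ps) {B : ℝ}
    (hB : ∀ᵐ x ∂m.law, |x| ≤ B) (l : ℕ) :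
    Integrable (fun ω : ℕ → Stage M => reward m share L z l ω) m.P := by
  refine Integrable.of_bound (measurable_reward (by positivity) l).aestronglyMeasurable B ?_
  filter_upwards [ae_abs_rewards_le (share := share) (L := L) (z := z) hζ hK hB] with ω hω
  exact (hω l).2

open Classical in
/-- Stagewise comparison of the reference policy and the algorithm. Exploration loses at most the
range of the qualities; agreement loses nothing; and all rewards are bounded. -/
theorem ae_reward_gap_le (hζ : 0 < m.ζ) (hK : 0 < m.K) (hps : 0 < m.ps) {B : ℝ}
    (hB : ∀ᵐ x ∂m.law, |x| ≤ B) (hmean : 0 < ∫ x, x ∂m.law) :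
    ∀ᵐ ω ∂m.P, ∀ l,
      (offlineReward m (ω l) - reward m share L z l ω
        ≤ m.Δstar * (if (explore L z l (memory m share L z ω (l - 1))).Nonempty then 1 else 0)
          + (Disagree m share L z l).indicator (fun _ => 2 * B) ω) ∧
      (reward m share L z l ω - offlineReward m (ω l)
        ≤ 2 * B * (if (explore L z l (memory m share L z ω (l - 1))).Nonempty then 1 else 0)
          + (Disagree m share L z l).indicator (fun _ => 2 * B) ω) := by
  have hc : 0 < m.ζ / (m.ps * m.K) := by positivity
  have hint : Integrable (fun x : ℝ => x) m.law := Integrable.of_bound (by fun_prop) B hB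
  have hstage : ∀ᵐ ω ∂m.P, ∀ l, (Set.ofPred (ω l).Success).Infinite ∧
      ∃ k, (ω l).StopsAt (fun _ => threshold (m.ζ / (m.ps * m.K)) m.law) k := by
    refine ae_all_iff.2 fun l => (measurePreserving_stage m l).quasiMeasurePreserving.ae
      (p := fun s => (Set.ofPred s.Success).Infinite ∧
        ∃ k, s.StopsAt (fun _ => threshold (m.ζ / (m.ps * m.K)) m.law) k) ?_
    filter_upwards [Stage.ae_infinite_success hps, Stage.ae_exists_stopsAt hps
      (θ := fun _ => threshold (m.ζ / (m.ps * m.K)) m.law)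
      fun _ => measure_Ici_threshold_pos hc hint hmean] with s h1 h2 using ⟨h1, h2⟩
  filter_upwards [hstage, ae_abs_rewards_le (share := share) (L := L) (z := z) hζ hK hB,
    ae_forall_sample (ae_essInf_le_and_le_essSup hB)] with ω hω hbound hrange l
  have h1 := abs_le.1 (hbound l).1
  have h2 := abs_le.1 (hbound l).2
  by_cases hE : (explore L z l (memory m share L z ω (l - 1))).Nonempty
  · have hnot : ω ∉ Disagree m share L z l := fun h => h.1 hE
    rw [if_pos hE, Set.indicator_of_notMem hnot]
    refine ⟨?_, by linarith⟩
    have hr : reward m share L z l ω = (ω l).rate m 0 := if_pos hE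
    rw [hr, mul_one, add_zero]
    exact Stage.thresholdReward_sub_rate_zero_le hζ hK (hω l).1 (fun k => (hrange l k).1)
      (fun k => (hrange l k).2) (threshold_nonneg hc hint) (hω l).2
  · rw [if_neg hE]
    by_cases hne : offlineReward m (ω l) = reward m share L z l ω
    · have hnot : ω ∉ Disagree m share L z l := fun h => h.2 hne
      rw [Set.indicator_of_notMem hnot, hne]
      simp
    · have hmem : ω ∈ Disagree m share L z l := ⟨hE, hne⟩
      rw [Set.indicator_of_mem hmem]
      constructor <;> linarith

/-! ### Sublinearity -/

theorem tendsto_sSum_div {q : ℝ} (hq : 0 < q) :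
    Tendsto (fun H : ℕ => sSum q H / H) atTop (𝓝 0) := by
  have h1 : Tendsto (fun n : ℕ => 1 / ((n : ℝ) + 1) ^ q) atTop (𝓝 0) := by
    have h2 : Tendsto (fun n : ℕ => ((n : ℝ) + 1) ^ q) atTop atTop :=
      (tendsto_rpow_atTop hq).comp
        (tendsto_atTop_add_const_right _ _ tendsto_natCast_atTop_atTop)
    simp only [one_div]
    exact h2.inv_tendsto_atTop
  refine h1.cesaro.congr fun H => ?_
  have h3 : sSum q H = ∑ i ∈ Finset.range H, 1 / ((i : ℝ) + 1) ^ q := by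
    unfold sSum
    induction H with
    | zero => simp
    | succ n ih => rw [Finset.sum_Icc_succ_top (by omega), ih, Finset.sum_range_succ]; simp
  rw [h3]
  ring

theorem tendsto_D₁_div (L : ℝ) (hz : z < 1) :
    Tendsto (fun H : ℕ => D₁ L z H / H) atTop (𝓝 0) := by
  have h1 : Tendsto (fun H : ℕ => L * (Real.log H / (H : ℝ) ^ (1 - z))) atTop (𝓝 (L * 0)) :=
    (((isLittleO_log_rpow_atTop (sub_pos.2 hz)).tendsto_div_nhds_zero).comp
      tendsto_natCast_atTop_atTop).const_mul L
  rw [mul_zero] at h1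
  refine h1.congr' ?_
  filter_upwards [eventually_gt_atTop 0] with H hH
  have h0 : (0 : ℝ) < H := by exact_mod_cast hH
  rw [Real.rpow_sub h0, Real.rpow_one, D₁]
  have := (Real.rpow_pos_of_pos h0 z).ne'
  field_simp

end OnlineMU

open OnlineMU in
theorem mainTheorem2 {M : ℕ} (m : ModelI M)
    (hζ : 0 < m.ζ) (hK : 0 < m.K) (hps : 0 < m.ps)
    (hbdd : ∃ B : ℝ, ∀ᵐ x ∂m.law, |x| ≤ B) (hmean : 0 < ∫ x, x ∂m.law)
    (lip α : ℝ) (hα : 0 < α)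
    (hLip : ∀ x δ : ℝ, |cdf m.law (x + δ) - cdf m.law x| ≤ lip * |δ| ^ α)
    (z : ℝ) (hz0 : 0 < z) (hz1 : z < 1)
    (share : Fin M → Finset (Fin M)) (hshare : ∀ j, j ∈ share j) :
    ∃ L₀ C₁ C₂ : ℝ, 0 < L₀ ∧ 0 < C₁ ∧ 0 < C₂ ∧ ∀ L : ℝ, L₀ ≤ L →
      (∀ H : ℕ,
        Integrable (fun ω => ∑ l ∈ Finset.Icc 1 H, offlineReward m (ω l)) m.P ∧
        Integrable (fun ω => ∑ l ∈ Finset.Icc 1 H, OnlineMU.reward m share L z l ω) m.P ∧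
        OnlineMU.regret m share L z H ≤
          m.Δstar * (M * L * (H : ℝ) ^ z * Real.log H
            + C₁ * sSum (α * z / 2) H + C₂ * sSum 2 H)) ∧
      Tendsto (fun H : ℕ => OnlineMU.regret m share L z H / H) atTop (𝓝 0) := by
  obtain ⟨B, hB⟩ := hbdd
  have hB0 : 0 ≤ B := by
    obtain ⟨x, hx⟩ := hB.exists
    exact (abs_nonneg x).trans hx
  have hc : 0 < m.ζ / (m.ps * m.K) := by positivity
  have hΔ : 0 < m.Δstar := sub_pos.2 (essInf_lt_essSup_of_cdf hB hα hLip)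
  set Cd := lip * 3 ^ α / m.law.real (Set.Ici (threshold (m.ζ / (m.ps * m.K)) m.law)) with hCd
  have hCd0 : 0 ≤ Cd := by
    have hlip0 : 0 ≤ lip := by simpa using (abs_nonneg _).trans (hLip 0 1)
    positivity
  have hαz : 0 < α * z / 2 := by positivity
  have hL₀ : 0 < (B + 1) ^ 2 / (m.ζ / (m.ps * m.K)) ^ 2 := by positivity
  -- the added `1` only makes the constants positive when `B = 0` or `lip = 0`
  refine ⟨_, 2 * B * Cd / m.Δstar + 1, 4 * B * M / m.Δstar + 1, hL₀, by positivity,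
    by positivity, fun L hL => ?_⟩
  have hL0 : 0 ≤ L := hL₀.le.trans hL
  have hs : ∀ q H, 0 ≤ sSum q H := fun q H => Finset.sum_nonneg fun l _ => by positivity
  have hIoff : ∀ H : ℕ, Integrable (fun ω => ∑ l ∈ Finset.Icc 1 H, offlineReward m (ω l)) m.P :=
    fun H => integrable_finsetSum _ fun l _ => integrable_offlineReward hζ hK hB l
  have hIrew : ∀ H : ℕ,
      Integrable (fun ω => ∑ l ∈ Finset.Icc 1 H, OnlineMU.reward m share L z l ω) m.P :=
    fun H => integrable_finsetSum _ fun l _ => integrable_reward hζ hK hps hB l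
  set d : ℕ → ℝ := fun l =>
    Cd * (1 / (l : ℝ) ^ (α * z / 2)) + 2 * M * (1 / (l : ℝ) ^ (2 : ℝ)) with hd
  have hdis : ∀ H : ℕ, ∀ l ∈ Finset.Icc 1 H, m.P.real (Disagree m share L z l) ≤ d l :=
    fun H l hl => measureReal_disagree_le hζ hK hps hB0 hB hmean hLip hz0.le hshare hL
      (Finset.mem_Icc.1 hl).1
  have hdsum : ∀ H : ℕ, ∑ l ∈ Finset.Icc 1 H, d l
      = Cd * sSum (α * z / 2) H + 2 * M * sSum 2 H := by
    intro H
    rw [hd, Finset.sum_add_distrib, ← Finset.mul_sum, ← Finset.mul_sum]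
    rfl
  have hgap := ae_reward_gap_le (share := share) (L := L) (z := z) hζ hK hps hB hmean
  have hupper : ∀ H : ℕ, regret m share L z H
      ≤ m.Δstar * (M * D₁ L z H) + 2 * B * (Cd * sSum (α * z / 2) H + 2 * M * sSum 2 H) := by
    intro H
    have h := integral_sum_le (f := fun l ω => offlineReward m (ω l) - reward m share L z l ω)
      hζ hK hps hL0 hz0.le hΔ.le (b := 2 * B) (by positivity) (hdis H)
      (by simp only [Finset.sum_sub_distrib]; exact (hIoff H).sub (hIrew H))
      (hgap.mono fun ω hω l _ => (hω l).1)
    simp only [Finset.sum_sub_distrib] at h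
    rwa [integral_sub (hIoff H) (hIrew H), hdsum] at h
  have hlower : ∀ H : ℕ, -regret m share L z H
      ≤ 2 * B * (M * D₁ L z H) + 2 * B * (Cd * sSum (α * z / 2) H + 2 * M * sSum 2 H) := by
    intro H
    have h := integral_sum_le (f := fun l ω => reward m share L z l ω - offlineReward m (ω l))
      hζ hK hps hL0 hz0.le (κ := 2 * B) (by positivity) (b := 2 * B) (by positivity) (hdis H)
      (by simp only [Finset.sum_sub_distrib]; exact (hIrew H).sub (hIoff H))
      (hgap.mono fun ω hω l _ => (hω l).2)
    simp only [Finset.sum_sub_distrib] at h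
    rw [integral_sub (hIrew H) (hIoff H), hdsum] at h
    rw [regret, neg_sub]
    exact h
  refine ⟨fun H => ⟨hIoff H, hIrew H, (hupper H).trans ?_⟩, ?_⟩
  · have h1 := hs (α * z / 2) H
    have h2 := hs 2 H
    have hexpand : m.Δstar * (M * L * (H : ℝ) ^ z * Real.log H
        + (2 * B * Cd / m.Δstar + 1) * sSum (α * z / 2) H
        + (4 * B * M / m.Δstar + 1) * sSum 2 H)
        = m.Δstar * (M * D₁ L z H) + 2 * B * (Cd * sSum (α * z / 2) H + 2 * M * sSum 2 H)
          + m.Δstar * (sSum (α * z / 2) H + sSum 2 H) := by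
      unfold D₁
      field_simp
      ring
    rw [hexpand]
    have : 0 ≤ m.Δstar * (sSum (α * z / 2) H + sSum 2 H) := by positivity
    linarith
  · have hlim : ∀ κ : ℝ, Tendsto (fun H : ℕ => (κ * (M * D₁ L z H)
        + 2 * B * (Cd * sSum (α * z / 2) H + 2 * M * sSum 2 H)) / H) atTop (𝓝 0) := by
      intro κ
      have h := ((tendsto_D₁_div L hz1).const_mul (κ * M)).add
        (((tendsto_sSum_div hαz).const_mul (2 * B * Cd)).add
          ((tendsto_sSum_div two_pos).const_mul (2 * B * (2 * M))))
      simp only [mul_zero, add_zero] at h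
      refine h.congr fun H => ?_
      ring
    have hneg := (hlim (2 * B)).neg
    rw [neg_zero] at hneg
    refine tendsto_of_tendsto_of_tendsto_of_le_of_le hneg (hlim m.Δstar) (fun H => ?_) fun H => ?_
    · rw [← neg_div]
      have := hlower H
      gcongr
      linarith
    · exact div_le_div_of_nonneg_right (hupper H) (Nat.cast_nonneg H)
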